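/- Let $(M^5,J,\theta)$ be a pseudohermitian manifold of dimension 5: $\theta$ is a contact form with contact bundle $\xi=\ker\theta$ and Reeb field $T$ (so $\theta(T)=1$, $L_T\theta=0$), $J$ is an integrable almost complex structure on $\xi$ ($J^2=-1$ and $[\xi_{1,0},\xi_{1,0}]\subset\xi_{1,0}$), and the Levi form $L_\theta(X,Y)=\tfrac12 d\theta(X,JY)$ is a Riemannian metric on $\xi$ (with $\alpha\wedge\beta(V,W)=\alpha(V)\beta(W)-\alpha(W)\beta(V)$ and $d\theta(X,Y)=X\theta(Y)-Y\theta(X)-\theta([X,Y])$). Orient $\xi$ by the orthonormal frames $(e_1,e_2,e_3,e_4)$ with $e_3=Je_1$, $e_4=Je_2$ (adapted frames), and let $Spin(\xi)$ be a spin structure on $\xi$. Let $S(4)=\Lambda^*_{\mathbb C}(2)$ be the complex span of $1,\omega^1,\omega^2,\omega^1\wedge\omega^2$, with $\epsilon_j$ the exterior multiplication by $\omega^j$ and $\iota_j$ the contraction dual to it, and $S^+(4)=\mathrm{span}\{1,\omega^1\wedge\omega^2\}$. The Clifford algebra of $\mathbb R^4$ (with $v\cdot v=-|v|^2$) acts on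 $S(4)$ by letting the $a$-th standard basis vector act as $E_a$, where $E_{2j-1}=\epsilon_j-\iota_j$, $E_{2j}=i(\epsilon_j+\iota_j)$, $j=1,2$. Let $\mathbb S^+\subset\mathbb S$ be the bundles associated to $Spin(\xi)$ with fibres $S^+(4)\subset S(4)$. In the trivialization given by a local section $\sigma$ of $Spin(\xi)$ over an adapted frame $(e_a)$, $e_a$ acts by Clifford multiplication as $E_a$. For an adapted frame put $Z_\alpha=\tfrac12(e_\alpha-ie_{2+\alpha})$, $\alpha=1,2$, with dual unitary coframe $\theta^\alpha$ ($\theta^\alpha(T)=0$), and let $\theta_\alpha{}^\beta,\tau^\beta$ be the unique one-forms with $$d\theta^\beta=\theta^\alpha\wedge\theta_\alpha{}^\beta+\theta\wedge\tau^\beta,\qquad \theta_\alpha{}^\beta+\overline{\theta_\beta{}^\alpha}=0,\qquad \textstyle\sum_\beta\overline{\tau^\beta}\wedge\theta^\beta=0.$$ The pseudohermitian connection $\nabla^{p.h.}$ is given by $\nabla^{p.h.}Z_\alpha=\theta_\alpha{}^\beta\otimes Z_\beta$ and conjugation; the curvature coefficient $R_\alpha{}^\beta{}_{\rho\bar\sigma}$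 is the coefficient of $\theta^\rho\wedge\overline{\theta^\sigma}$ in $d\theta_\alpha{}^\beta-\theta_\alpha{}^\gamma\wedge\theta_\gamma{}^\beta$, and $W=\sum_{\gamma,\beta}R_\gamma{}^\gamma{}_{\beta\bar\beta}$ is the Tanaka--Webster scalar curvature. The spin connection on $\mathbb S$ is, in the trivialization given by $\sigma$, $$\nabla_X\varphi=X\varphi+\tfrac14\sum_{a,b=1}^4 L_\theta(\nabla^{p.h.}_Xe_a,e_b)\,e_ae_b\,\varphi .$$ Put $\nabla^2_{V,U}\varphi=\nabla_V\nabla_U\varphi-\nabla_{\nabla^{p.h.}_VU}\varphi$, $\ \nabla^*\nabla\varphi=-\sum_{a=1}^4\nabla^2_{e_a,e_a}\varphi$, and let $D_\xi\varphi=\sum_{a=1}^4e_a\cdot\nabla_{e_a}\varphi$ be the contact Dirac operator. Then $\sum_{\beta=1}^2e_\beta e_{2+\beta}=0$ on $S^+(4)$ for the Clifford action, that is, $E_1E_3+E_2E_4=0$ on $S^+(4)$, and likewise $\sum_{\beta=1}^2 e_\beta\cdot e_{2+\beta}\cdot{}=0$ on $\mathbb S^+$ for every adapted frame that is the image of a local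 section $\sigma$ of $Spin(\xi)$; and, for every smooth section $\varphi$ of $\mathbb S^+$, $$D_\xi^2\varphi=\nabla^*\nabla\varphi+W\varphi .$$ -/

import Mathlib

open scoped Manifold ContDiff

noncomputable section

namespace PseudohermitianSpin

/-! ## The spinor module `S(4)` and its Clifford multiplication -/

/-- `S(2n)`, the complex span of the exterior monomials `ω^{j₁} ∧ ⋯ ∧ ω^{j_k}`, `j₁ < ⋯ < j_k`.
An element is given by its coefficients, the monomial being recorded as the set of its indices. -/
abbrev Spinor (n : ℕ) : Type := Finset (Fin n) → ℂ

/-- The sign of moving `ω^j` past the factors `ω^k` with `k ∈ K`, `k < j`. -/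
def monomialSign {n : ℕ} (j : Fin n) (K : Finset (Fin n)) : ℂ :=
  (-1) ^ (K.filter (fun k => k < j)).card

/-- `ε_j : ω^K ↦ ω^j ∧ ω^K`. -/
def wedgeOp {n : ℕ} (j : Fin n) : Module.End ℂ (Spinor n) where
  toFun f K := if j ∈ K then monomialSign j (K.erase j) * f (K.erase j) else 0
  map_add' f g := by
    funext K
    by_cases h : j ∈ K <;> simp [h, mul_add]
  map_smul' c f := by
    funext K
    by_cases h : j ∈ K <;> simp [h, mul_left_comm]

/-- `ι_j`, which removes `ω^j` from `ω^K` (with the sign of its position), and is `0` on `ω^K`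
when `j ∉ K`. -/
def contractOp {n : ℕ} (j : Fin n) : Module.End ℂ (Spinor n) where
  toFun f K := if j ∈ K then 0 else monomialSign j K * f (insert j K)
  map_add' f g := by
    funext K
    by_cases h : j ∈ K <;> simp [h, mul_add]
  map_smul' c f := by
    funext K
    by_cases h : j ∈ K <;> simp [h, mul_left_comm]

/-- The endomorphisms `E_1 = ε_1 - ι_1`, `E_2 = i(ε_1 + ι_1)`, `E_3 = ε_2 - ι_2`,
`E_4 = i(ε_2 + ι_2)` of `S(4)` (indices shifted to start at `0`). -/
def cliffordE : Fin 4 → Module.End ℂ (Spinor 2)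
  | 0 => wedgeOp 0 - contractOp 0
  | 1 => Complex.I • (wedgeOp 0 + contractOp 0)
  | 2 => wedgeOp 1 - contractOp 1
  | 3 => Complex.I • (wedgeOp 1 + contractOp 1)

/-- The positive spinors `S⁺(4)`: the span of the monomials of even degree. -/
def positiveSpinors : Submodule ℂ (Spinor 2) where
  carrier := {f | ∀ K : Finset (Fin 2), Odd K.card → f K = 0}
  zero_mem' := by intro K _; rfl
  add_mem' := by
    intro f g hf hg K hK
    simp [hf K hK, hg K hK]
  smul_mem' := by
    intro c f hf K hK
    simp [hf K hK]

/-- The negative definite form `v ↦ -|v|²` on `ℝ⁴`, so that `v · v = -|v|²` in the Clifford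
algebra. -/
abbrev negForm : QuadraticForm ℝ (Fin 4 → ℝ) :=
  QuadraticMap.weightedSumSquares ℝ (fun _ : Fin 4 => (-1 : ℝ))

/-- The Clifford action `v ↦ ∑ v_a E_a` of `ℝ⁴` on `S(4)`. -/
def cliffordVec : (Fin 4 → ℝ) →ₗ[ℝ] Module.End ℂ (Spinor 2) where
  toFun v := ∑ a, v a • cliffordE a
  map_add' v w := by simp [add_smul, Finset.sum_add_distrib]
  map_smul' c v := by simp [mul_smul, Finset.smul_sum]

theorem finset_fin_two_cases (K : Finset (Fin 2)) : K = ∅ ∨ K = {0} ∨ K = {1} ∨ K = {0, 1} := by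
  revert K
  decide

theorem cliffordVec_apply (v : Fin 4 → ℝ) (f : Spinor 2) :
    cliffordVec v f ∅ = (-v 0 + v 1 * Complex.I) * f {0} + (-v 2 + v 3 * Complex.I) * f {1} ∧
    cliffordVec v f {0} = (v 0 + v 1 * Complex.I) * f ∅ + (v 2 - v 3 * Complex.I) * f {0, 1} ∧
    cliffordVec v f {1} = (v 2 + v 3 * Complex.I) * f ∅ + (-v 0 + v 1 * Complex.I) * f {0, 1} ∧
    cliffordVec v f {0, 1} =
      (v 0 + v 1 * Complex.I) * f {1} + (-v 2 - v 3 * Complex.I) * f {0} := by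
  have e0 : ({0, 1} : Finset (Fin 2)).erase 0 = {1} := by decide
  have e1 : ({0, 1} : Finset (Fin 2)).erase 1 = {0} := by decide
  have i0 : insert 1 ({0} : Finset (Fin 2)) = {0, 1} := by decide
  have f0 : ({0} : Finset (Fin 2)).filter (fun x => x = 0) = {0} := by decide
  refine ⟨?_, ?_, ?_, ?_⟩ <;>
    simp [cliffordVec, cliffordE, Fin.sum_univ_four, wedgeOp, contractOp, monomialSign, e0, e1, i0,
      f0] <;> ring

theorem cliffordVec_sq (v : Fin 4 → ℝ) :
    cliffordVec v * cliffordVec v = algebraMap ℝ (Module.End ℂ (Spinor 2)) (negForm v) := by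
  have hI : Complex.I ^ 2 = -1 := Complex.I_sq
  refine LinearMap.ext fun f => funext fun K => ?_
  have h := cliffordVec_apply v
  have hr : algebraMap ℝ (Module.End ℂ (Spinor 2)) (negForm v) f K
      = -((v 0 : ℂ) ^ 2 + (v 1 : ℂ) ^ 2 + (v 2 : ℂ) ^ 2 + (v 3 : ℂ) ^ 2) * f K := by
    simp [Algebra.algebraMap_eq_smul_one, QuadraticMap.weightedSumSquares_apply,
      Fin.sum_univ_four]
    left
    ring
  rw [hr, Module.End.mul_apply]
  rcases finset_fin_two_cases K with rfl | rfl | rfl | rfl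
  · rw [(h _).1, (h f).2.1, (h f).2.2.1]
    linear_combination ((v 1 : ℂ) ^ 2 + (v 3 : ℂ) ^ 2) * f ∅ * hI
  · rw [(h _).2.1, (h f).1, (h f).2.2.2]
    linear_combination ((v 1 : ℂ) ^ 2 + (v 3 : ℂ) ^ 2) * f {0} * hI
  · rw [(h _).2.2.1, (h f).1, (h f).2.2.2]
    linear_combination ((v 1 : ℂ) ^ 2 + (v 3 : ℂ) ^ 2) * f {1} * hI
  · rw [(h _).2.2.2, (h f).2.1, (h f).2.2.1]
    linear_combination ((v 1 : ℂ) ^ 2 + (v 3 : ℂ) ^ 2) * f {0, 1} * hI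

/-- The representation `𝒩` of the real Clifford algebra of `(ℝ⁴, -|·|²)` on `S(4)`. -/
def cliffordRep : CliffordAlgebra negForm →ₐ[ℝ] Module.End ℂ (Spinor 2) :=
  CliffordAlgebra.lift negForm ⟨cliffordVec, cliffordVec_sq⟩

/-! ## Vector fields and one-forms on a 5-manifold -/

section Fields

variable {M : Type*} [TopologicalSpace M] [ChartedSpace (EuclideanSpace ℝ (Fin 5)) M]
  {F : Type*} [NormedAddCommGroup F] [NormedSpace ℝ F]

variable (M) in
/-- (Not necessarily smooth) vector fields on `M`. -/
abbrev VField : Type _ := ∀ x : M, TangentSpace (𝓡 5) x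

variable (M F) in
/-- (Not necessarily smooth) `F`-valued one-forms on `M`. -/
abbrev OneForm : Type _ := ∀ x : M, TangentSpace (𝓡 5) x →L[ℝ] F

/-- Smooth vector field on the set `U`. -/
def VField.SmoothOn [IsManifold (𝓡 5) ∞ M] (X : VField M) (U : Set M) : Prop :=
  ContMDiffOn (𝓡 5) (𝓡 5).tangent ∞ (fun x => (⟨x, X x⟩ : TangentBundle (𝓡 5) M)) U

/-- Smooth one-form on the open set `U`: its value on every smooth vector field on an open subset
is smooth. -/
def OneForm.SmoothOn [IsManifold (𝓡 5) ∞ M] (α : OneForm M F) (U : Set M) : Prop :=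
  ∀ V : Set M, IsOpen V → V ⊆ U → ∀ X : VField M, VField.SmoothOn X V →
    ContMDiffOn (𝓡 5) 𝓘(ℝ, F) ∞ (fun x => α x (X x)) V

/-- The derivative of the function `f` at `x` in the direction of the vector field `X`. -/
def dirDeriv (X : VField M) (f : M → F) (x : M) : F :=
  mfderiv (𝓡 5) 𝓘(ℝ, F) f x (X x)

/-- `dα(X, Y) = X(α(Y)) - Y(α(X)) - α([X, Y])`. -/
def extD (α : OneForm M F) (X Y : VField M) (x : M) : F :=
  dirDeriv X (fun y => α y (Y y)) x - dirDeriv Y (fun y => α y (X y)) x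
    - α x (VectorField.mlieBracket (𝓡 5) X Y x)

/-- `(L_T α)(X) = T(α(X)) - α([T, X])`. -/
def lieD (T : VField M) (α : OneForm M F) (X : VField M) (x : M) : F :=
  dirDeriv T (fun y => α y (X y)) x - α x (VectorField.mlieBracket (𝓡 5) T X x)

/-- `(α ∧ β)(X, Y) = α(X) β(Y) - α(Y) β(X)` for complex one-forms. -/
def wedge (α β : OneForm M ℂ) (X Y : VField M) (x : M) : ℂ :=
  α x (X x) * β x (Y x) - α x (Y x) * β x (X x)

/-- A real one-form, viewed as a complex one. -/
def OneForm.toComplex (α : OneForm M ℝ) : OneForm M ℂ := fun x => Complex.ofRealCLM.comp (α x)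

/-- The complex conjugate of a complex one-form. -/
def OneForm.conj (α : OneForm M ℂ) : OneForm M ℂ :=
  fun x => (Complex.conjCLE : ℂ →L[ℝ] ℂ).comp (α x)

end Fields

section Geometry

variable (M : Type*) [TopologicalSpace M] [ChartedSpace (EuclideanSpace ℝ (Fin 5)) M]
  [IsManifold (𝓡 5) ∞ M]

/-- A pseudohermitian structure `(J, θ)` on a 5-manifold `M`, with contact bundle `ξ = ker θ` and
Reeb field `T`. The endomorphism `J` of `ξ` is extended to `TM` by `J T = 0`. Positivity of the
Levi form makes `dθ` nondegenerate on `ξ`, so that `θ ∧ (dθ)² ≠ 0`. -/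
structure PseudohermitianStructure where
  /-- the contact form -/
  θ : OneForm M ℝ
  /-- the almost complex structure of `ξ` -/
  J : ∀ x : M, TangentSpace (𝓡 5) x →L[ℝ] TangentSpace (𝓡 5) x
  /-- the Reeb vector field -/
  T : VField M
  smooth_θ : OneForm.SmoothOn θ Set.univ
  smooth_J : ∀ U : Set M, IsOpen U → ∀ X : VField M, VField.SmoothOn X U →
    VField.SmoothOn (fun x => J x (X x)) U
  smooth_T : VField.SmoothOn T Set.univ
  θ_J : ∀ x v, θ x (J x v) = 0
  J_J : ∀ x v, θ x v = 0 → J x (J x v) = -v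
  J_T : ∀ x, J x (T x) = 0
  θ_T : ∀ x, θ x (T x) = 1
  lie_T : ∀ U : Set M, IsOpen U → ∀ X : VField M, VField.SmoothOn X U →
    ∀ x ∈ U, lieD T θ X x = 0
  /-- `[ξ₁₀, ξ₁₀] ⊆ ξ₁₀`, written for the sections `X - iJX`, `Y - iJY` of `ξ₁₀`: their bracket
  is `([X,Y] - [JX,JY]) - i([JX,Y] + [X,JY])`, and it lies in `ξ₁₀` when its real part `A` is in
  `ξ` and its imaginary part is `-JA`. -/
  integrable : ∀ U : Set M, IsOpen U → ∀ X Y : VField M,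
    VField.SmoothOn X U → VField.SmoothOn Y U →
    (∀ x ∈ U, θ x (X x) = 0) → (∀ x ∈ U, θ x (Y x) = 0) → ∀ x ∈ U,
      θ x (VectorField.mlieBracket (𝓡 5) X Y x
        - VectorField.mlieBracket (𝓡 5) (fun y => J y (X y)) (fun y => J y (Y y)) x) = 0 ∧
      VectorField.mlieBracket (𝓡 5) (fun y => J y (X y)) Y x
        + VectorField.mlieBracket (𝓡 5) X (fun y => J y (Y y)) x
        = J x (VectorField.mlieBracket (𝓡 5) X Y x
          - VectorField.mlieBracket (𝓡 5) (fun y => J y (X y)) (fun y => J y (Y y)) x)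
  levi_pos : ∀ U : Set M, IsOpen U → ∀ X : VField M, VField.SmoothOn X U →
    (∀ x ∈ U, θ x (X x) = 0) → ∀ x ∈ U, X x ≠ 0 →
      0 < (1 / 2 : ℝ) * extD θ X (fun y => J y (X y)) x

variable {M}

/-- The Levi metric `L_θ(X, Y) = ½ dθ(X, JY)` (for sections `X`, `Y` of `ξ`). -/
def PseudohermitianStructure.levi (P : PseudohermitianStructure M) (X Y : VField M) (x : M) : ℝ :=
  (1 / 2 : ℝ) * extD P.θ X (fun y => P.J y (Y y)) x

/-- A smooth orthonormal frame `e_1, …, e_4` of `ξ` over an open set `U` with `e_3 = J e_1`,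
`e_4 = J e_2` (indices shifted to start at `0`), together with the one-forms `ω^1, …, ω^4` that
form with `θ` the coframe dual to `e_1, …, e_4, T`. -/
structure AdaptedFrame (P : PseudohermitianStructure M) where
  U : Set M
  isOpen_U : IsOpen U
  e : Fin 4 → VField M
  smooth_e : ∀ a, VField.SmoothOn (e a) U
  θ_e : ∀ a, ∀ x ∈ U, P.θ x (e a x) = 0
  J_e_zero : ∀ x ∈ U, P.J x (e 0 x) = e 2 x
  J_e_one : ∀ x ∈ U, P.J x (e 1 x) = e 3 x
  orthonormal : ∀ a b, ∀ x ∈ U, P.levi (e a) (e b) x = if a = b then 1 else 0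
  coframe : Fin 4 → OneForm M ℝ
  smooth_coframe : ∀ a, OneForm.SmoothOn (coframe a) U
  coframe_e : ∀ a b, ∀ x ∈ U, coframe a x (e b x) = if a = b then 1 else 0
  coframe_T : ∀ a, ∀ x ∈ U, coframe a x (P.T x) = 0

namespace AdaptedFrame

variable {P : PseudohermitianStructure M} (F : AdaptedFrame P)

/-- The index of `e_β`, `β = 1, 2`. -/
def idx (β : Fin 2) : Fin 4 := Fin.castAdd 2 β

/-- The index of `e_{2+β} = J e_β`, `β = 1, 2`. -/
def idxJ (β : Fin 2) : Fin 4 := Fin.natAdd 2 β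

/-- The unitary coframe `θ^β = ω^β + i ω^{2+β}`. -/
def thetaC (β : Fin 2) : OneForm M ℂ :=
  fun x => (F.coframe (idx β)).toComplex x + Complex.I • (F.coframe (idxJ β)).toComplex x

/-- The full frame `T, e_1, …, e_4` of `TM` over `U`. -/
def full : Option (Fin 4) → VField M
  | none => P.T
  | some a => F.e a

end AdaptedFrame

variable (M) in
/-- Candidates for the connection forms `θ_α^β` (`conn α β`) and the torsion forms `τ^β` of the
pseudohermitian (Tanaka–Webster) connection. -/
structure ConnectionForms where
  conn : Fin 2 → Fin 2 → OneForm M ℂ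
  tors : Fin 2 → OneForm M ℂ

instance : Nonempty (ConnectionForms M) := ⟨⟨fun _ _ _ => 0, fun _ _ => 0⟩⟩

/-- Webster's structure equations over the domain of the frame:
`dθ^β = θ^α ∧ θ_α^β + θ ∧ τ^β`, `0 = θ_α^β + conj θ_β^α`, `0 = ∑ τ_β ∧ θ^β` with
`τ_β = conj τ^β`. Identities of two-forms are tested on all pairs from the frame
`T, e_1, …, e_4` of `TM`. -/
structure IsPseudohermitianConnection {P : PseudohermitianStructure M} (F : AdaptedFrame P)
    (Γ : ConnectionForms M) : Prop where
  smooth_conn : ∀ α β, OneForm.SmoothOn (Γ.conn α β) F.U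
  smooth_tors : ∀ β, OneForm.SmoothOn (Γ.tors β) F.U
  structure_eq : ∀ β, ∀ A B : Option (Fin 4), ∀ x ∈ F.U,
    extD (F.thetaC β) (F.full A) (F.full B) x =
      (∑ α, wedge (F.thetaC α) (Γ.conn α β) (F.full A) (F.full B) x)
        + wedge P.θ.toComplex (Γ.tors β) (F.full A) (F.full B) x
  skew : ∀ α β, ∀ x ∈ F.U, ∀ v, Γ.conn α β x v + (Γ.conn β α).conj x v = 0
  tors_symm : ∀ A B : Option (Fin 4), ∀ x ∈ F.U,
    ∑ β, wedge (Γ.tors β).conj (F.thetaC β) (F.full A) (F.full B) x = 0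

namespace AdaptedFrame

variable {P : PseudohermitianStructure M} (F : AdaptedFrame P)

/-- The connection and torsion forms of the pseudohermitian connection in the given frame: the
solution of the structure equations (which is unique over `U`). -/
def forms : ConnectionForms M := Classical.epsilon (IsPseudohermitianConnection F)

/-- The connection forms `θ_α^β`. -/
def connC (α β : Fin 2) : OneForm M ℂ := F.forms.conn α β

/-- The real connection forms `ω_a^b`, for which `∇^{p.h.} e_a = ∑_b ω_a^b e_b`. They are
determined by `θ_α^β = ω_α^β + i ω_α^{2+β}`, `ω_{2+α}^β = -ω_α^{2+β}`,
`ω_{2+α}^{2+β} = ω_α^β`. -/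
def connR (a b : Fin 4) (x : M) (v : TangentSpace (𝓡 5) x) : ℝ :=
  match a, b with
  | 0, 0 => (F.connC 0 0 x v).re
  | 0, 1 => (F.connC 0 1 x v).re
  | 0, 2 => (F.connC 0 0 x v).im
  | 0, 3 => (F.connC 0 1 x v).im
  | 1, 0 => (F.connC 1 0 x v).re
  | 1, 1 => (F.connC 1 1 x v).re
  | 1, 2 => (F.connC 1 0 x v).im
  | 1, 3 => (F.connC 1 1 x v).im
  | 2, 0 => -(F.connC 0 0 x v).im
  | 2, 1 => -(F.connC 0 1 x v).im
  | 2, 2 => (F.connC 0 0 x v).re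
  | 2, 3 => (F.connC 0 1 x v).re
  | 3, 0 => -(F.connC 1 0 x v).im
  | 3, 1 => -(F.connC 1 1 x v).im
  | 3, 2 => (F.connC 1 0 x v).re
  | 3, 3 => (F.connC 1 1 x v).re

/-- The curvature forms `dθ_α^β - ∑_γ θ_α^γ ∧ θ_γ^β`. -/
def curvForm (α β : Fin 2) (X Y : VField M) (x : M) : ℂ :=
  extD (F.connC α β) X Y x - ∑ γ, wedge (F.connC α γ) (F.connC γ β) X Y x

/-- `R_α^β_{ρσ̄}`, the coefficient of `θ^ρ ∧ conj θ^σ` in the curvature form: the value of its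
complex bilinear extension on `Z_ρ = ½(e_ρ - i e_{2+ρ})` and `conj Z_σ = ½(e_σ + i e_{2+σ})`. -/
def curv (α β ρ σ : Fin 2) (x : M) : ℂ :=
  (1 / 4 : ℂ) * (F.curvForm α β (F.e (idx ρ)) (F.e (idx σ)) x
    + Complex.I * F.curvForm α β (F.e (idx ρ)) (F.e (idxJ σ)) x
    - Complex.I * F.curvForm α β (F.e (idxJ ρ)) (F.e (idx σ)) x
    + F.curvForm α β (F.e (idxJ ρ)) (F.e (idxJ σ)) x)

/-- The pseudohermitian Ricci tensor `R_{αβ̄} = ∑_γ R_γ^γ_{αβ̄}`. -/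
def ricci (α β : Fin 2) (x : M) : ℂ := ∑ γ, F.curv γ γ α β x

/-- The Tanaka–Webster scalar curvature `W = ∑_β R_{ββ̄}` (a real number). -/
def scalarW (x : M) : ℝ := (∑ β, F.ricci β β x).re

/-! ### Spinors in the trivialization given by a lift of the frame

A spinor field over `U` is represented by a function `M → S(4)`. -/

/-- Clifford multiplication by `v ∈ ξ_x`. -/
def clifford (x : M) (v : TangentSpace (𝓡 5) x) : Module.End ℂ (Spinor 2) :=
  cliffordVec (fun a => F.coframe a x v)

/-- The spin connection form `ω_σ(v) = ¼ ∑_{a,b} ⟨∇^{p.h.}_v e_a, e_b⟩ e_a e_b`. -/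
def spinForm (x : M) (v : TangentSpace (𝓡 5) x) : Module.End ℂ (Spinor 2) :=
  (1 / 4 : ℝ) • ∑ a, ∑ b, F.connR a b x v • (cliffordE a * cliffordE b)

/-- The spin connection `∇_X φ = X(φ) + ω_σ(X) φ`. -/
def nabla (X : VField M) (φ : M → Spinor 2) (x : M) : Spinor 2 :=
  dirDeriv X φ x + F.spinForm x (X x) (φ x)

/-- The vector field `∇^{p.h.}_V e_b`. -/
def nablaE (V : VField M) (b : Fin 4) : VField M :=
  fun x => ∑ c, F.connR b c x (V x) • F.e c x

/-- The invariant second derivative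
`∇²_{e_a, e_b} φ = ∇_{e_a} ∇_{e_b} φ - ∇_{∇^{p.h.}_{e_a} e_b} φ`. -/
def nabla2 (a b : Fin 4) (φ : M → Spinor 2) (x : M) : Spinor 2 :=
  F.nabla (F.e a) (F.nabla (F.e b) φ) x - F.nabla (F.nablaE (F.e a) b) φ x

/-- The contact Dirac operator `D_ξ φ = ∑_a e_a · ∇_{e_a} φ`. -/
def dirac (φ : M → Spinor 2) (x : M) : Spinor 2 :=
  ∑ a, F.clifford x (F.e a x) (F.nabla (F.e a) φ x)

/-- The connection Laplacian `∇*∇ φ = -∑_a ∇²_{e_a, e_a} φ`. -/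
def connLaplacian (φ : M → Spinor 2) (x : M) : Spinor 2 :=
  -∑ a, F.nabla2 a a φ x

end AdaptedFrame

/-- A spin structure on `ξ`, given by the transition functions of the principal `Spin(4)`-bundle
`Spin(ξ)`: `M` is covered by the domains of adapted frames `e^i`, and on overlaps the change of
frame `e^j_b = ∑_a ρ(g_ij)_{ab} e^i_a` is lifted to smooth functions `g_ij` with values in
`Spin(4)` that satisfy the cocycle condition. (The frame `e^i` is the image of a section `σ_i` of
`Spin(ξ)`, and `σ_j = σ_i g_ij`. Here `ξ` has the orientation of the frames
`e_1, e_2, Je_1, Je_2`.) -/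
structure SpinStructure (P : PseudohermitianStructure M) (ι : Type*) where
  frame : ι → AdaptedFrame P
  cover : ∀ x, ∃ i, x ∈ (frame i).U
  g : ι → ι → M → spinGroup negForm
  smooth_g : ∀ i j, ∀ s : Spinor 2,
    ContMDiffOn (𝓡 5) 𝓘(ℝ, Spinor 2) ∞ (fun x => cliffordRep (g i j x : CliffordAlgebra negForm) s)
      ((frame i).U ∩ (frame j).U)
  lift : ∀ i j, ∀ x ∈ (frame i).U ∩ (frame j).U, ∀ b : Fin 4,
    (g i j x : CliffordAlgebra negForm) * CliffordAlgebra.ι negForm (Pi.single b 1)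
        * star (g i j x : CliffordAlgebra negForm)
      = ∑ a, (frame i).coframe a x ((frame j).e b x) • CliffordAlgebra.ι negForm (Pi.single a 1)
  cocycle : ∀ i j k, ∀ x ∈ (frame i).U ∩ (frame j).U ∩ (frame k).U,
    g i j x * g j k x = g i k x

namespace SpinStructure

variable {P : PseudohermitianStructure M} {ι : Type*} (S : SpinStructure P ι)

/-- `φ` is a smooth section of the spinor bundle `𝕊 = Spin(ξ) ×_𝒩 S(4)`: a family of smooth
functions `φ_i` with `φ = [σ_i, φ_i]` over the domain of the `i`-th frame. -/
def IsSection (φ : ι → M → Spinor 2) : Prop :=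
  (∀ i, ContMDiffOn (𝓡 5) 𝓘(ℝ, Spinor 2) ∞ (φ i) (S.frame i).U) ∧
  ∀ i j, ∀ x ∈ (S.frame i).U ∩ (S.frame j).U,
    φ i x = cliffordRep (S.g i j x : CliffordAlgebra negForm) (φ j x)

/-- `φ` is a smooth section of the bundle `𝕊⁺ = Spin(ξ) ×_𝒩 S⁺(4)` of positive spinors. -/
def IsPositiveSection (φ : ι → M → Spinor 2) : Prop :=
  S.IsSection φ ∧ ∀ i, ∀ x ∈ (S.frame i).U, φ i x ∈ positiveSpinors

/-- The contact Dirac operator on spinor fields. -/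
def dirac (φ : ι → M → Spinor 2) : ι → M → Spinor 2 := fun i => (S.frame i).dirac (φ i)

/-- The connection Laplacian `∇*∇` on spinor fields. -/
def connLaplacian (φ : ι → M → Spinor 2) : ι → M → Spinor 2 :=
  fun i => (S.frame i).connLaplacian (φ i)

end SpinStructure

end Geometry

end PseudohermitianSpin

end

/-! Clifford multiplication is parallel for the spin connection, so D_ξ²φ = ∑ e_a e_b ∇²_{a,b}φ
(`nabla_dirac`). Since e_a² = -1, the diagonal terms make up ∇*∇φ. Off the diagonal the e_a
anticommute, so only ∇²_{a,b} - ∇²_{b,a} matters. The Ricci identity `nabla2_sub_nabla2` evaluates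
it as the spin action of the curvature Ω(e_a, e_b) minus dθ(e_a, e_b) ∇_T φ; the second term appears
because [e_a, e_b] has T-component -dθ(e_a, e_b).

Two facts about S⁺ finish the argument. The ∇_T terms add up to -2(e_1 e_3 + e_2 e_4)∇_T φ, and this
vanishes because ∇_T φ is again positive and dθ is anti-self-dual for the orientation (e_1, e_2,
Je_1, Je_2), hence acts trivially on S⁺ (`commute_reeb_positive`). The curvature terms ∑_{a<b} e_a
e_b Ω(e_a, e_b) act on S⁺ as a quaternion: by the first Bianchi identity its three imaginary
components vanish and its real part is W, while the torsion cancels by its symmetry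
(`IsCurvature.relations`, `IsCurvature.clifford_contraction`).

The connection forms are chosen by `Classical.epsilon`, so a solution of the structure equations has
to be exhibited (`exists_connection`). Everything is expressed through the structure functions of
the frame T, e_1, …, e_4. As dθ is constant on this frame, the θ-component of the Jacobi identity is
linear in them. Together with integrability it shows that the candidate forced by the equations is a
solution. The remaining components of the Jacobi identity give the Bianchi identity. -/

namespace PseudohermitianSpin

noncomputable section

/-! ### Directional derivatives and brackets of vector fields -/

section Calculus

variable {M : Type*} [TopologicalSpace M] [ChartedSpace (EuclideanSpace ℝ (Fin 5)) M]
  {F : Type*} [NormedAddCommGroup F] [NormedSpace ℝ F]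
  {G : Type*} [NormedAddCommGroup G] [NormedSpace ℝ G]

/-- A smooth function on `U` with values in a normed space. -/
abbrev SmoothFun (f : M → F) (U : Set M) : Prop := ContMDiffOn (𝓡 5) 𝓘(ℝ, F) ∞ f U

theorem SmoothFun.mdifferentiableAt {f : M → F} {U : Set M} (hf : SmoothFun f U) (hU : IsOpen U)
    {x : M} (hx : x ∈ U) : MDifferentiableAt (𝓡 5) 𝓘(ℝ, F) f x :=
  (hf.contMDiffAt (hU.mem_nhds hx)).mdifferentiableAt (by simp)

theorem dirDeriv_eq_mvfderiv (X : VField M) (f : M → F) (x : M) :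
    dirDeriv X f x = mvfderiv (𝓡 5) f x (X x) := rfl

theorem dirDeriv_congr (X : VField M) {f g : M → F} {U : Set M} (hU : IsOpen U)
    (h : ∀ y ∈ U, f y = g y) {x : M} (hx : x ∈ U) : dirDeriv X f x = dirDeriv X g x := by
  have : f =ᶠ[nhds x] g := Filter.eventuallyEq_of_mem (hU.mem_nhds hx) h
  unfold dirDeriv
  rw [this.mfderiv_eq]
  rfl

theorem dirDeriv_const (X : VField M) (c : F) (x : M) : dirDeriv X (fun _ => c) x = 0 := by
  rw [dirDeriv_eq_mvfderiv, mvfderiv_const]; rfl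

theorem dirDeriv_eq_zero (X : VField M) {f : M → F} (c : F) {U : Set M} (hU : IsOpen U)
    (h : ∀ y ∈ U, f y = c) {x : M} (hx : x ∈ U) : dirDeriv X f x = 0 := by
  rw [dirDeriv_congr X hU h hx, dirDeriv_const]

theorem dirDeriv_add (X : VField M) {f g : M → F} {x : M}
    (hf : MDifferentiableAt (𝓡 5) 𝓘(ℝ, F) f x) (hg : MDifferentiableAt (𝓡 5) 𝓘(ℝ, F) g x) :
    dirDeriv X (fun y => f y + g y) x = dirDeriv X f x + dirDeriv X g x := by
  simp only [dirDeriv_eq_mvfderiv]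
  exact congrArg (fun L => L (X x)) (mvfderiv_add hf hg)

theorem dirDeriv_sum (X : VField M) {κ : Type*} (s : Finset κ) {f : κ → M → F} {x : M}
    (hf : ∀ k ∈ s, MDifferentiableAt (𝓡 5) 𝓘(ℝ, F) (f k) x) :
    dirDeriv X (fun y => ∑ k ∈ s, f k y) x = ∑ k ∈ s, dirDeriv X (f k) x ∧
      MDifferentiableAt (𝓡 5) 𝓘(ℝ, F) (fun y => ∑ k ∈ s, f k y) x := by
  classical
  induction s using Finset.induction_on with
  | empty => simpa [dirDeriv_const] using mdifferentiableAt_const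
  | insert a s ha ih =>
    have ih := ih fun k hk => hf k (Finset.mem_insert_of_mem hk)
    have h1 := hf a (Finset.mem_insert_self _ _)
    simp only [Finset.sum_insert ha]
    exact ⟨by rw [dirDeriv_add X h1 ih.2, ih.1], h1.add ih.2⟩

theorem dirDeriv_smul (X : VField M) {a : M → ℝ} {g : M → F} {x : M}
    (ha : MDifferentiableAt (𝓡 5) 𝓘(ℝ, ℝ) a x) (hg : MDifferentiableAt (𝓡 5) 𝓘(ℝ, F) g x) :
    dirDeriv X (fun y => a y • g y) x = a x • dirDeriv X g x + dirDeriv X a x • g x := by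
  simp only [dirDeriv_eq_mvfderiv]
  have := congrArg (fun L => L (X x)) (mvfderiv_smul ha hg)
  simp only [add_apply, smul_apply,
    ContinuousLinearMap.smulRight_apply] at this
  exact this

theorem dirDeriv_clm (X : VField M) (L : F →L[ℝ] G) {f : M → F} {x : M}
    (hf : MDifferentiableAt (𝓡 5) 𝓘(ℝ, F) f x) :
    dirDeriv X (fun y => L (f y)) x = L (dirDeriv X f x) := by
  have h1 : MDifferentiableAt 𝓘(ℝ, F) 𝓘(ℝ, G) L (f x) := L.differentiableAt.mdifferentiableAt
  have := mfderiv_comp_apply x h1 hf (X x)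
  unfold dirDeriv
  rw [mfderiv_eq_fderiv, L.fderiv] at this
  exact this

theorem SmoothFun.clm (L : F →L[ℝ] G) {f : M → F} {U : Set M} (hf : SmoothFun f U) :
    SmoothFun (fun y => L (f y)) U :=
  L.contMDiff.comp_contMDiffOn hf

theorem dirDeriv_field_sum {κ : Type*} (s : Finset κ) (a : κ → M → ℝ) (X : κ → VField M)
    (V : VField M) (f : M → F) (x : M) (hV : V x = ∑ k ∈ s, a k x • X k x) :
    dirDeriv V f x = ∑ k ∈ s, a k x • dirDeriv (X k) f x := by
  simp only [dirDeriv_eq_mvfderiv, hV, map_sum, map_smul]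

variable [IsManifold (𝓡 5) ∞ M]

theorem VField.SmoothOn.mdifferentiableAt {X : VField M} {U : Set M} (hX : X.SmoothOn U)
    (hU : IsOpen U) {x : M} (hx : x ∈ U) :
    MDifferentiableAt (𝓡 5) (𝓡 5).tangent (fun x => (⟨x, X x⟩ : TangentBundle (𝓡 5) M)) x :=
  (hX.contMDiffAt (hU.mem_nhds hx)).mdifferentiableAt (by simp)

theorem VField.SmoothOn.smul {X : VField M} {f : M → ℝ} {U : Set M} (hf : SmoothFun f U)
    (hX : X.SmoothOn U) : VField.SmoothOn (f • X) U :=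
  ContMDiffOn.smul_section hf hX

theorem VField.SmoothOn.add {X Y : VField M} {U : Set M}
    (hX : X.SmoothOn U) (hY : Y.SmoothOn U) : VField.SmoothOn (X + Y) U :=
  ContMDiffOn.add_section hX hY

theorem VField.SmoothOn.sub {X Y : VField M} {U : Set M}
    (hX : X.SmoothOn U) (hY : Y.SmoothOn U) : VField.SmoothOn (X - Y) U :=
  ContMDiffOn.sub_section hX hY

theorem VField.SmoothOn.mlieBracket {X Y : VField M} {U : Set M} (hU : IsOpen U)
    (hX : X.SmoothOn U) (hY : Y.SmoothOn U) :
    VField.SmoothOn (VectorField.mlieBracket (𝓡 5) X Y) U := by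
  have : IsManifold (𝓡 5) (minSmoothness ℝ 2) M := by
    simp only [minSmoothness_of_isRCLikeNormedField]; infer_instance
  have : IsManifold (𝓡 5) ((⊤ : ℕ∞) + 1 : ℕ∞ω) M := by
    simpa using (inferInstance : IsManifold (𝓡 5) ∞ M)
  exact fun x hx => (ContMDiffAt.mlieBracket_vectorField (n := ⊤) (m := ⊤) (hX.contMDiffAt (hU.mem_nhds hx))
    (hY.contMDiffAt (hU.mem_nhds hx)) (by simp)).contMDiffWithinAt

omit [IsManifold (𝓡 5) ∞ M] in
theorem mlieBracket_congr {X X' Y Y' : VField M} {U : Set M} (hU : IsOpen U)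
    (h : ∀ y ∈ U, X y = X' y) (h' : ∀ y ∈ U, Y y = Y' y) {x : M} (hx : x ∈ U) :
    VectorField.mlieBracket (𝓡 5) X Y x = VectorField.mlieBracket (𝓡 5) X' Y' x :=
  Filter.EventuallyEq.mlieBracket_vectorField_eq
    (Filter.eventuallyEq_of_mem (hU.mem_nhds hx) h) (Filter.eventuallyEq_of_mem (hU.mem_nhds hx) h')

theorem mlieBracket_smul (X : VField M) {Y : VField M} {f : M → ℝ} {U : Set M} (hU : IsOpen U)
    (hf : SmoothFun f U) (hY : Y.SmoothOn U) {x : M} (hx : x ∈ U) :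
    VectorField.mlieBracket (𝓡 5) X (f • Y) x
      = dirDeriv X f x • Y x + f x • VectorField.mlieBracket (𝓡 5) X Y x :=
  VectorField.mlieBracket_smul_right (hf.mdifferentiableAt hU hx) (hY.mdifferentiableAt hU hx)

theorem mlieBracket_jacobi {X Y Z : VField M} {U : Set M} (hU : IsOpen U)
    (hX : X.SmoothOn U) (hY : Y.SmoothOn U) (hZ : Z.SmoothOn U) {x : M} (hx : x ∈ U) :
    VectorField.mlieBracket (𝓡 5) X (VectorField.mlieBracket (𝓡 5) Y Z) x =
      VectorField.mlieBracket (𝓡 5) (VectorField.mlieBracket (𝓡 5) X Y) Z x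
        + VectorField.mlieBracket (𝓡 5) Y (VectorField.mlieBracket (𝓡 5) X Z) x := by
  have : IsManifold (𝓡 5) (minSmoothness ℝ 3) M := by
    simp only [minSmoothness_of_isRCLikeNormedField]; infer_instance
  have two_le : minSmoothness ℝ 2 ≤ ∞ := by
    rw [minSmoothness_of_isRCLikeNormedField]
    exact WithTop.coe_le_coe.2 (OrderTop.le_top (2 : ℕ∞))
  refine VectorField.leibniz_identity_mlieBracket_apply ?_ ?_ ?_
  · exact (hX.contMDiffAt (hU.mem_nhds hx)).of_le two_le
  · exact (hY.contMDiffAt (hU.mem_nhds hx)).of_le two_le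
  · exact (hZ.contMDiffAt (hU.mem_nhds hx)).of_le two_le

/-- A nowhere vanishing vector field lets one read off derivatives of functions from brackets. -/
theorem SmoothFun.dirDeriv_real {θ : OneForm M ℝ} {T X : VField M} {U : Set M} (hU : IsOpen U)
    (hθ : θ.SmoothOn U) (hT : T.SmoothOn U) (hθT : ∀ x, θ x (T x) = 1) (hX : X.SmoothOn U)
    {f : M → ℝ} (hf : SmoothFun f U) : SmoothFun (dirDeriv X f) U := by
  -- [X, fT] - f[X, T] = (Xf) T, and θ(T) = 1. Smoothness of Xf thus follows from smoothness of
  -- brackets, without charts.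
  have h1 := hθ U hU subset_rfl _
    ((VField.SmoothOn.mlieBracket hU hX (hT.smul hf)).sub
      ((VField.SmoothOn.mlieBracket hU hX hT).smul hf))
  refine h1.congr fun x hx => ?_
  simp only [Pi.sub_apply, mlieBracket_smul X hU hf hT hx, Pi.smul_apply', add_sub_cancel_right,
    map_smul, hθT, smul_eq_mul, mul_one]

/-- Compare the Jacobi identity for X, Y, fT with f times the one for X, Y, T. The terms (Yf)[X, T]
+ (Xf)[Y, T] are symmetric in X and Y and cancel; what remains is a multiple of T, which θ reads
off. -/
theorem dirDeriv_mlieBracket_real {θ : OneForm M ℝ} {T X Y : VField M} {U : Set M} (hU : IsOpen U)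
    (hθ : θ.SmoothOn U) (hT : T.SmoothOn U) (hθT : ∀ x, θ x (T x) = 1) (hX : X.SmoothOn U)
    (hY : Y.SmoothOn U) {f : M → ℝ} (hf : SmoothFun f U) {x : M} (hx : x ∈ U) :
    dirDeriv (VectorField.mlieBracket (𝓡 5) X Y) f x
      = dirDeriv X (dirDeriv Y f) x - dirDeriv Y (dirDeriv X f) x := by
  have expand : ∀ {X Y : VField M}, X.SmoothOn U → Y.SmoothOn U →
      VectorField.mlieBracket (𝓡 5) X (VectorField.mlieBracket (𝓡 5) Y (f • T)) x
        = dirDeriv X (dirDeriv Y f) x • T x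
          + dirDeriv Y f x • VectorField.mlieBracket (𝓡 5) X T x
          + (dirDeriv X f x • VectorField.mlieBracket (𝓡 5) Y T x
          + f x • VectorField.mlieBracket (𝓡 5) X (VectorField.mlieBracket (𝓡 5) Y T) x) := by
    intro X Y hX hY
    have hYf := SmoothFun.dirDeriv_real hU hθ hT hθT hY hf
    have hYT := VField.SmoothOn.mlieBracket hU hY hT
    rw [mlieBracket_congr (Y' := dirDeriv Y f • T + f • VectorField.mlieBracket (𝓡 5) Y T) hU
      (fun _ _ => rfl) (fun y hy => mlieBracket_smul Y hU hf hT hy) hx,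
      VectorField.mlieBracket_add_right ((hT.smul hYf).mdifferentiableAt hU hx)
        ((hYT.smul hf).mdifferentiableAt hU hx),
      mlieBracket_smul X hU hYf hT hx, mlieBracket_smul X hU hf hYT hx]
  have j1 := mlieBracket_jacobi hU hX hY (hT.smul hf) hx
  have j2 := mlieBracket_jacobi hU hX hY hT hx
  rw [expand hX hY, expand hY hX, mlieBracket_smul _ hU hf hT hx, j2] at j1
  have := congrArg (θ x) j1
  simp only [map_add, map_smul, hθT, smul_eq_mul] at this
  linear_combination -this

theorem SmoothFun.dirDeriv_complex {θ : OneForm M ℝ} {T X : VField M} {U : Set M} (hU : IsOpen U)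
    (hθ : θ.SmoothOn U) (hT : T.SmoothOn U) (hθT : ∀ x, θ x (T x) = 1) (hX : X.SmoothOn U)
    {f : M → ℂ} (hf : SmoothFun f U) : SmoothFun (dirDeriv X f) U := by
  have hr := SmoothFun.dirDeriv_real hU hθ hT hθT hX (hf.clm Complex.reCLM)
  have hi := SmoothFun.dirDeriv_real hU hθ hT hθT hX (hf.clm Complex.imCLM)
  refine ((hr.clm Complex.ofRealCLM).add
    ((hi.clm Complex.ofRealCLM).clm (Complex.I • ContinuousLinearMap.id ℝ ℂ))).congr
    fun x hx => ?_
  have hd := hf.mdifferentiableAt hU hx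
  have e1 := dirDeriv_clm X Complex.reCLM hd
  have e2 := dirDeriv_clm X Complex.imCLM hd
  simp only [Pi.add_apply, e1, e2]
  apply Complex.ext <;> simp

theorem dirDeriv_mlieBracket_complex {θ : OneForm M ℝ} {T X Y : VField M} {U : Set M}
    (hU : IsOpen U)
    (hθ : θ.SmoothOn U) (hT : T.SmoothOn U) (hθT : ∀ x, θ x (T x) = 1) (hX : X.SmoothOn U)
    (hY : Y.SmoothOn U) {f : M → ℂ} (hf : SmoothFun f U) {x : M} (hx : x ∈ U) :
    dirDeriv (VectorField.mlieBracket (𝓡 5) X Y) f x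
      = dirDeriv X (dirDeriv Y f) x - dirDeriv Y (dirDeriv X f) x := by
  have key : ∀ L : ℂ →L[ℝ] ℝ, L (dirDeriv (VectorField.mlieBracket (𝓡 5) X Y) f x)
      = L (dirDeriv X (dirDeriv Y f) x - dirDeriv Y (dirDeriv X f) x) := by
    intro L
    have h := dirDeriv_mlieBracket_real hU hθ hT hθT hX hY (hf.clm L) hx
    have e : ∀ Z : VField M, ∀ y ∈ U, dirDeriv Z (fun y => L (f y)) y = L (dirDeriv Z f y) :=
      fun Z y hy => dirDeriv_clm Z L (hf.mdifferentiableAt hU hy)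
    rw [e _ x hx, dirDeriv_congr X hU (e Y) hx, dirDeriv_congr Y hU (e X) hx,
      dirDeriv_clm X L ((SmoothFun.dirDeriv_complex hU hθ hT hθT hY hf).mdifferentiableAt hU hx),
      dirDeriv_clm Y L ((SmoothFun.dirDeriv_complex hU hθ hT hθT hX hf).mdifferentiableAt hU hx)]
      at h
    rw [h, map_sub]
  exact Complex.ext (key Complex.reCLM) (key Complex.imCLM)

theorem SmoothFun.dirDeriv_spinor {θ : OneForm M ℝ} {T X : VField M} {U : Set M} (hU : IsOpen U)
    (hθ : θ.SmoothOn U) (hT : T.SmoothOn U) (hθT : ∀ x, θ x (T x) = 1) (hX : X.SmoothOn U)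
    {f : M → Spinor 2} (hf : SmoothFun f U) : SmoothFun (dirDeriv X f) U := by
  refine contMDiffOn_pi_space.2 fun K => ?_
  refine (SmoothFun.dirDeriv_complex hU hθ hT hθT hX
    (hf.clm (ContinuousLinearMap.proj (R := ℝ) (φ := fun _ : Finset (Fin 2) => ℂ) K))).congr
    fun x hx => ?_
  rw [dirDeriv_clm X _ (hf.mdifferentiableAt hU hx)]
  rfl

theorem dirDeriv_mlieBracket_spinor {θ : OneForm M ℝ} {T X Y : VField M} {U : Set M}
    (hU : IsOpen U)
    (hθ : θ.SmoothOn U) (hT : T.SmoothOn U) (hθT : ∀ x, θ x (T x) = 1) (hX : X.SmoothOn U)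
    (hY : Y.SmoothOn U) {f : M → Spinor 2} (hf : SmoothFun f U) {x : M} (hx : x ∈ U) :
    dirDeriv (VectorField.mlieBracket (𝓡 5) X Y) f x
      = dirDeriv X (dirDeriv Y f) x - dirDeriv Y (dirDeriv X f) x := by
  funext K
  set L := ContinuousLinearMap.proj (R := ℝ) (φ := fun _ : Finset (Fin 2) => ℂ) K
  have h := dirDeriv_mlieBracket_complex hU hθ hT hθT hX hY (hf.clm L) hx
  have e : ∀ Z : VField M, ∀ y ∈ U, dirDeriv Z (fun y => L (f y)) y = L (dirDeriv Z f y) :=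
    fun Z y hy => dirDeriv_clm Z L (hf.mdifferentiableAt hU hy)
  rw [e _ x hx, dirDeriv_congr X hU (e Y) hx, dirDeriv_congr Y hU (e X) hx,
    dirDeriv_clm X L ((SmoothFun.dirDeriv_spinor hU hθ hT hθT hY hf).mdifferentiableAt hU hx),
    dirDeriv_clm Y L ((SmoothFun.dirDeriv_spinor hU hθ hT hθT hX hf).mdifferentiableAt hU hx)]
    at h
  exact h

end Calculus

/-! ### Structure functions of an adapted frame -/

section FrameBrackets

variable {M : Type*} [TopologicalSpace M] [ChartedSpace (EuclideanSpace ℝ (Fin 5)) M]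
  [IsManifold (𝓡 5) ∞ M]

theorem mlieBracket_sum_smul (X : VField M) {κ : Type*} (s : Finset κ) {f : κ → M → ℝ}
    {Y : κ → VField M} {U : Set M} (hU : IsOpen U) (hf : ∀ k, SmoothFun (f k) U)
    (hY : ∀ k, (Y k).SmoothOn U) {x : M} (hx : x ∈ U) :
    VField.SmoothOn (∑ k ∈ s, f k • Y k) U ∧
    VectorField.mlieBracket (𝓡 5) X (∑ k ∈ s, f k • Y k) x
      = ∑ k ∈ s, (dirDeriv X (f k) x • Y k x
        + f k x • VectorField.mlieBracket (𝓡 5) X (Y k) x) := by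
  classical
  induction s using Finset.induction_on with
  | empty =>
    simp only [Finset.sum_empty, VectorField.mlieBracket_zero_right, Pi.zero_apply, and_true]
    exact (Bundle.contMDiff_zeroSection ℝ
      (TangentSpace (𝓡 5) : M → Type _)).contMDiffOn
  | insert a s ha ih =>
    have h1 := (hY a).smul (hf a)
    simp only [Finset.sum_insert ha]
    refine ⟨h1.add ih.1, ?_⟩
    rw [VectorField.mlieBracket_add_right (h1.mdifferentiableAt hU hx)
      (ih.1.mdifferentiableAt hU hx), ih.2, mlieBracket_smul X hU (hf a) (hY a) hx]

variable {P : PseudohermitianStructure M}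

/-- The Levi form matrix `dθ(e_a, e_b)` of an adapted frame. -/
def leviMatrix : Fin 4 → Fin 4 → ℝ :=
  ![![0, 0, 2, 0], ![0, 0, 0, 2], ![-2, 0, 0, 0], ![0, -2, 0, 0]]

namespace AdaptedFrame

variable (F : AdaptedFrame P)

/-- The coframe `θ, ω^1, …, ω^4` dual to `T, e_1, …, e_4`. -/
def dual : Option (Fin 4) → OneForm M ℝ
  | none => P.θ
  | some a => F.coframe a

/-- The structure functions of the frame: `[A, B] = ∑_C br A B C · C`. -/
def br (A B C : Option (Fin 4)) (x : M) : ℝ :=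
  F.dual C x (VectorField.mlieBracket (𝓡 5) (F.full A) (F.full B) x)

variable {F}

theorem dual_full {x : M} (hx : x ∈ F.U) (A B : Option (Fin 4)) :
    F.dual A x (F.full B x) = if A = B then 1 else 0 := by
  rcases A with _ | a <;> rcases B with _ | b
  · simp [dual, full, P.θ_T]
  · simp [dual, full, F.θ_e b x hx]
  · simp [dual, full, F.coframe_T a x hx]
  · simp [dual, full, F.coframe_e a b x hx]

theorem expand {x : M} (hx : x ∈ F.U) (v : TangentSpace (𝓡 5) x) :
    v = ∑ A, F.dual A x v • F.full A x := by
  let Ψ : (Option (Fin 4) → ℝ) →ₗ[ℝ] TangentSpace (𝓡 5) x :=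
    Fintype.linearCombination ℝ (fun A => F.full A x)
  have hΨ : ∀ c A, F.dual A x (Ψ c) = c A := by
    intro c A
    simp [Ψ, Fintype.linearCombination_apply, map_sum, dual_full hx, -Fintype.sum_option]
  have hinj : Function.Injective Ψ := fun c c' h => by
    funext A
    rw [← hΨ c A, h, hΨ]
  have hfin : Module.finrank ℝ (TangentSpace (𝓡 5) x) = 5 :=
    finrank_euclideanSpace_fin (𝕜 := ℝ) (n := 5)
  have : FiniteDimensional ℝ (TangentSpace (𝓡 5) x) :=
    inferInstanceAs (FiniteDimensional ℝ (EuclideanSpace ℝ (Fin 5)))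
  -- The dual forms provide a left inverse of `Ψ`, and both spaces have dimension 5, so injectivity
  -- gives spanning.
  obtain ⟨c, rfl⟩ := (LinearMap.injective_iff_surjective_of_finrank_eq_finrank
    (by rw [hfin]; simp)).1 hinj v
  simp only [hΨ]
  rfl

variable (F)

theorem smooth_full (A : Option (Fin 4)) : (F.full A).SmoothOn F.U := by
  rcases A with _ | a
  · exact ContMDiffOn.mono P.smooth_T (Set.subset_univ _)
  · exact F.smooth_e a

theorem smooth_θ_U : OneForm.SmoothOn P.θ F.U := fun V hV _ => P.smooth_θ V hV (Set.subset_univ _)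

theorem smooth_dual (A : Option (Fin 4)) : (F.dual A).SmoothOn F.U := by
  rcases A with _ | a
  · exact F.smooth_θ_U
  · exact F.smooth_coframe a

theorem smooth_br (A B C : Option (Fin 4)) : SmoothFun (F.br A B C) F.U :=
  F.smooth_dual C _ F.isOpen_U subset_rfl _
    (VField.SmoothOn.mlieBracket F.isOpen_U (F.smooth_full A) (F.smooth_full B))

theorem br_anti (A B C : Option (Fin 4)) (x : M) : F.br A B C x = -F.br B A C x := by
  unfold br
  rw [VectorField.mlieBracket_swap_apply, map_neg]

variable {F}

theorem mlieBracket_full {x : M} (hx : x ∈ F.U) (A B : Option (Fin 4)) :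
    VectorField.mlieBracket (𝓡 5) (F.full A) (F.full B) x = ∑ C, F.br A B C x • F.full C x :=
  expand hx _

theorem dual_mlieBracket_mlieBracket {x : M} (hx : x ∈ F.U) (A B C D : Option (Fin 4)) :
    F.dual D x (VectorField.mlieBracket (𝓡 5) (F.full A)
        (VectorField.mlieBracket (𝓡 5) (F.full B) (F.full C)) x)
      = dirDeriv (F.full A) (F.br B C D) x + ∑ E, F.br B C E x * F.br A E D x := by
  rw [mlieBracket_congr (Y' := ∑ E, F.br B C E • F.full E) F.isOpen_U (fun _ _ => rfl)
    (fun y hy => (mlieBracket_full hy B C).trans (by simp)) hx,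
    (mlieBracket_sum_smul _ _ F.isOpen_U (F.smooth_br B C) F.smooth_full hx).2]
  simp [map_sum, map_add, dual_full hx, Finset.sum_add_distrib, br, -Fintype.sum_option]

/-- The Jacobi identity for the frame, in terms of the structure functions. -/
theorem jacobi {x : M} (hx : x ∈ F.U) (A B C D : Option (Fin 4)) :
    (dirDeriv (F.full A) (F.br B C D) x + ∑ E, F.br B C E x * F.br A E D x)
      + (dirDeriv (F.full B) (F.br C A D) x + ∑ E, F.br C A E x * F.br B E D x)
      + (dirDeriv (F.full C) (F.br A B D) x + ∑ E, F.br A B E x * F.br C E D x) = 0 := by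
  have h := congrArg (F.dual D x) (mlieBracket_jacobi F.isOpen_U (F.smooth_full A)
    (F.smooth_full B) (F.smooth_full C) hx)
  rw [VectorField.mlieBracket_swap_apply
    (V := VectorField.mlieBracket (𝓡 5) (F.full A) (F.full B)), map_add, map_neg] at h
  simp only [dual_mlieBracket_mlieBracket hx] at h
  have hd : dirDeriv (F.full B) (F.br A C D) x = -dirDeriv (F.full B) (F.br C A D) x := by
    rw [dirDeriv_congr (F.full B) F.isOpen_U
      (g := fun y => (-ContinuousLinearMap.id ℝ ℝ) (F.br C A D y))
      (fun y _ => by simp [F.br_anti A C D y]) hx,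
      dirDeriv_clm _ _ ((F.smooth_br C A D).mdifferentiableAt F.isOpen_U hx)]
    rfl
  have hs : ∑ E, F.br A C E x * F.br B E D x = -∑ E, F.br C A E x * F.br B E D x := by
    rw [← Finset.sum_neg_distrib]
    exact Finset.sum_congr rfl fun E _ => by rw [F.br_anti A C E x, neg_mul]
  rw [hd, hs] at h
  linear_combination h

theorem br_none_none {x : M} (A : Option (Fin 4)) (C : Option (Fin 4)) : F.br A A C x = 0 := by
  have := F.br_anti A A C x
  linarith

/-- The dual forms are constant on the frame, so only the bracket term of the exterior derivative
survives. -/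
theorem extD_dual {x : M} (hx : x ∈ F.U) (A B C : Option (Fin 4)) :
    extD (F.dual C) (F.full A) (F.full B) x = -F.br A B C x := by
  unfold extD br
  rw [dirDeriv_eq_zero _ _ F.isOpen_U (fun y hy => dual_full hy C B) hx,
    dirDeriv_eq_zero _ _ F.isOpen_U (fun y hy => dual_full hy C A) hx]
  simp

theorem J_e_two {x : M} (hx : x ∈ F.U) : P.J x (F.e 2 x) = -F.e 0 x := by
  rw [← F.J_e_zero x hx, P.J_J x _ (F.θ_e 0 x hx)]

theorem J_e_three {x : M} (hx : x ∈ F.U) : P.J x (F.e 3 x) = -F.e 1 x := by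
  rw [← F.J_e_one x hx, P.J_J x _ (F.θ_e 1 x hx)]

/-- Orthonormality of e_a, e_b reads ½ dθ(e_a, e_c) = δ_ab with e_c = Je_b, and dθ(e_a, e_c) =
-θ([e_a, e_c]). -/
theorem levi_e_of_J {x : M} (hx : x ∈ F.U) (a b c : Fin 4)
    (h : ∀ y ∈ F.U, P.J y (F.e b y) = F.e c y) :
    F.br (some a) (some c) none x = if a = b then -2 else 0 := by
  have h1 := F.orthonormal a b x hx
  have h2 : extD P.θ (F.e a) (fun y => P.J y (F.e b y)) x
      = extD P.θ (F.e a) (F.e c) x := by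
    unfold extD
    rw [dirDeriv_congr _ F.isOpen_U (g := fun y => P.θ y (F.e c y))
        (fun y hy => congrArg (P.θ y) (h y hy)) hx,
      mlieBracket_congr F.isOpen_U (fun _ _ => rfl) h hx]
    congr 2
    exact congrArg (mfderiv (𝓡 5) 𝓘(ℝ, ℝ) (fun y => P.θ y (F.e a y)) x) (h x hx)
  have h3 : extD P.θ (F.e a) (F.e c) x = -F.br (some a) (some c) none x :=
    extD_dual hx (some a) (some c) none
  unfold PseudohermitianStructure.levi at h1
  rw [h2, h3] at h1
  split_ifs at h1 ⊢ <;> linarith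

/-- The integrability condition for X = e_1, Y = e_2, split into its components along T and e_1, …,
e_4. In complex dimension two this single pair carries all the information. -/
theorem integrable_frame {x : M} (hx : x ∈ F.U) :
    F.br (some 0) (some 1) none x = F.br (some 2) (some 3) none x ∧
    F.br (some 2) (some 1) (some 0) x + F.br (some 0) (some 3) (some 0) x
      = -(F.br (some 0) (some 1) (some 2) x - F.br (some 2) (some 3) (some 2) x) ∧
    F.br (some 2) (some 1) (some 1) x + F.br (some 0) (some 3) (some 1) x
      = -(F.br (some 0) (some 1) (some 3) x - F.br (some 2) (some 3) (some 3) x) ∧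
    F.br (some 2) (some 1) (some 2) x + F.br (some 0) (some 3) (some 2) x
      = F.br (some 0) (some 1) (some 0) x - F.br (some 2) (some 3) (some 0) x ∧
    F.br (some 2) (some 1) (some 3) x + F.br (some 0) (some 3) (some 3) x
      = F.br (some 0) (some 1) (some 1) x - F.br (some 2) (some 3) (some 1) x := by
  obtain ⟨h1, h2⟩ := P.integrable F.U F.isOpen_U (F.e 0) (F.e 1) (F.smooth_e 0) (F.smooth_e 1)
    (F.θ_e 0) (F.θ_e 1) x hx
  rw [mlieBracket_congr F.isOpen_U F.J_e_zero F.J_e_one hx] at h1 h2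
  rw [mlieBracket_congr F.isOpen_U F.J_e_zero (fun _ _ => rfl) hx,
    mlieBracket_congr F.isOpen_U (fun _ _ => rfl) F.J_e_one hx] at h2
  have key : ∀ w : TangentSpace (𝓡 5) x, P.J x w = F.coframe 0 x w • F.e 2 x
      + F.coframe 1 x w • F.e 3 x - F.coframe 2 x w • F.e 0 x - F.coframe 3 x w • F.e 1 x := by
    intro w
    conv_lhs => rw [expand hx w]
    simp only [map_add, map_smul, Fintype.sum_option, Fin.sum_univ_four, dual, full,
      F.J_e_zero x hx, F.J_e_one x hx, J_e_two hx, J_e_three hx, P.J_T, smul_zero, zero_add,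
      smul_neg]
    abel
  rw [key] at h2
  refine ⟨by simpa [sub_eq_zero, br, dual] using! h1, ?_, ?_, ?_, ?_⟩
  · simpa [F.coframe_e _ _ x hx, br, dual] using! congrArg (F.coframe 0 x) h2
  · simpa [F.coframe_e _ _ x hx, br, dual] using! congrArg (F.coframe 1 x) h2
  · simpa [F.coframe_e _ _ x hx, br, dual] using! congrArg (F.coframe 2 x) h2
  · simpa [F.coframe_e _ _ x hx, br, dual] using! congrArg (F.coframe 3 x) h2

/-- `θ([e_a, e_b]) = -dθ(e_a, e_b)`. -/
theorem br_none {x : M} (hx : x ∈ F.U) (a b : Fin 4) :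
    F.br (some a) (some b) none x = -leviMatrix a b := by
  have h2 := fun a => levi_e_of_J hx a 0 2 F.J_e_zero
  have h3 := fun a => levi_e_of_J hx a 1 3 F.J_e_one
  have h0 := fun a => (F.br_anti (some 2) (some a) none x)
  have h1 := fun a => (F.br_anti (some 3) (some a) none x)
  -- The pair (e_1, e_2) is not of the form (e_a, Je_b). Integrability replaces its bracket by
  -- [Je_1, Je_2], whose θ-component vanishes because Je_1 is orthogonal to e_2.
  have h01 := (integrable_frame hx).1
  rw [h3 2] at h01
  have h10 := F.br_anti (some 1) (some 0) none x
  rw [h01] at h10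
  fin_cases a <;> fin_cases b <;>
    simp [leviMatrix, h01, h10, h0 0, h0 1, h1 0, h1 1, h2, h3, br_none_none]

theorem br_reeb {x : M} (hx : x ∈ F.U) (A : Option (Fin 4)) : F.br none A none x = 0 := by
  rcases A with _ | a
  · exact br_none_none _ _
  · have h := P.lie_T F.U F.isOpen_U (F.e a) (F.smooth_e a) x hx
    unfold lieD at h
    rw [dirDeriv_eq_zero _ 0 F.isOpen_U (F.θ_e a) hx, zero_sub, neg_eq_zero] at h
    exact h

/-- The θ-components of the brackets are constant on U. This removes the derivative terms from the
θ-component of the Jacobi identity, that is from d(dθ) = 0, and leaves linear relations. -/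
theorem dirDeriv_br_none {x : M} (hx : x ∈ F.U) (X : VField M) (A B : Option (Fin 4)) :
    dirDeriv X (F.br A B none) x = 0 := by
  rcases A with _ | a
  · exact dirDeriv_eq_zero X 0 F.isOpen_U (fun y hy => br_reeb hy B) hx
  · rcases B with _ | b
    · exact dirDeriv_eq_zero X 0 F.isOpen_U
        (fun y hy => by rw [F.br_anti, br_reeb hy, neg_zero]) hx
    · exact dirDeriv_eq_zero X _ F.isOpen_U (fun y hy => br_none hy a b) hx

end AdaptedFrame

end FrameBrackets

/-! ## Existence of the pseudohermitian connection -/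

section ConnectionAlgebra

open AdaptedFrame

/-- Structure functions `c A B C` of a frame `T, e_1, …, e_4` at a point. -/
abbrev StructureConstants : Type := Option (Fin 4) → Option (Fin 4) → Option (Fin 4) → ℝ

namespace StructureConstants

variable (c : StructureConstants)

/-- `θ^β([A, B])`. -/
def complexBr (β : Fin 2) (A B : Option (Fin 4)) : ℂ :=
  Complex.ofRealCLM (c A B (some (idx β))) + Complex.I * Complex.ofRealCLM (c A B (some (idxJ β)))

/-- `θ^β([Z_α, conj Z_γ])`. -/
def mixedBr (α γ β : Fin 2) : ℂ :=
  (1 / 4 : ℂ) * (c.complexBr β (some (idx α)) (some (idx γ))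
    + Complex.I * c.complexBr β (some (idx α)) (some (idxJ γ))
    - Complex.I * c.complexBr β (some (idxJ α)) (some (idx γ))
    + c.complexBr β (some (idxJ α)) (some (idxJ γ)))

/-- `-θ^β([T, conj Z_α])`. -/
def reebBr (β α : Fin 2) : ℂ :=
  -(1 / 2 : ℂ) * (c.complexBr β none (some (idx α))
    + Complex.I * c.complexBr β none (some (idxJ α)))

/-- The values of `θ_α^β` on the frame. -/
def connCoeff (α β : Fin 2) : Option (Fin 4) → ℂ
  -- These values are forced. The structure equation on (T, Z_α), with τ^β(Z_α) = 0, gives θ_α^β(T)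
  -- = θ^β([T, Z_α]). On (Z_α, conj Z_γ) it gives θ_α^β(conj Z_γ) = -θ^β([Z_α, conj Z_γ]), and
  -- skewness then determines θ_α^β(Z_γ). Finally e_γ = Z_γ + conj Z_γ and Je_γ = i(Z_γ - conj Z_γ).
  | none => (1 / 2 : ℂ) * (c.complexBr β none (some (idx α))
      - Complex.I * c.complexBr β none (some (idxJ α)))
  | some 0 => Complex.conjCLE (c.mixedBr β 0 α) - c.mixedBr α 0 β
  | some 1 => Complex.conjCLE (c.mixedBr β 1 α) - c.mixedBr α 1 β
  | some 2 => Complex.I * (Complex.conjCLE (c.mixedBr β 0 α) + c.mixedBr α 0 β)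
  | some 3 => Complex.I * (Complex.conjCLE (c.mixedBr β 1 α) + c.mixedBr α 1 β)

/-- The values of `τ^β` on the frame. -/
def torsCoeff (β : Fin 2) : Option (Fin 4) → ℂ
  | none => 0
  | some 0 => c.reebBr β 0
  | some 1 => c.reebBr β 1
  | some 2 => -Complex.I * c.reebBr β 0
  | some 3 => -Complex.I * c.reebBr β 1

end StructureConstants

/-- The values of `θ^β` on the frame. -/
def thetaFrame (β : Fin 2) (A : Option (Fin 4)) : ℂ :=
  (if some (idx β) = A then 1 else 0) + Complex.I * (if some (idxJ β) = A then 1 else 0)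

/-- The values of `dθ` on the frame. -/
def leviFull : Option (Fin 4) → Fin 4 → ℝ
  | none, _ => 0
  | some a, d => leviMatrix a d

/-- The linear relations between the structure constants of an adapted frame. -/
structure StructureConstants.Admissible (c : StructureConstants) : Prop where
  anti : ∀ A B C, c A B C = -c B A C
  jacobi : ∀ A B C, ∑ d, c B C (some d) * leviFull A d + ∑ d, c C A (some d) * leviFull B d
    + ∑ d, c A B (some d) * leviFull C d = 0
  integrable_zero : c (some 2) (some 1) (some 0) + c (some 0) (some 3) (some 0)
      = -(c (some 0) (some 1) (some 2) - c (some 2) (some 3) (some 2))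
  integrable_one : c (some 2) (some 1) (some 1) + c (some 0) (some 3) (some 1)
      = -(c (some 0) (some 1) (some 3) - c (some 2) (some 3) (some 3))
  integrable_two : c (some 2) (some 1) (some 2) + c (some 0) (some 3) (some 2)
      = c (some 0) (some 1) (some 0) - c (some 2) (some 3) (some 0)
  integrable_three : c (some 2) (some 1) (some 3) + c (some 0) (some 3) (some 3)
      = c (some 0) (some 1) (some 1) - c (some 2) (some 3) (some 1)

@[simp] theorem idx_zero : idx 0 = 0 := rfl
@[simp] theorem idx_one : idx 1 = 1 := rfl
@[simp] theorem idxJ_zero : idxJ 0 = 2 := rfl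
@[simp] theorem idxJ_one : idxJ 1 = 3 := rfl

namespace StructureConstants.Admissible

variable {c : StructureConstants} (h : c.Admissible)
include h

/-- On ξ skewness is built into the coefficients. On T it expresses that bracketing with T preserves
dθ, which is the Jacobi relation with first entry T. -/
theorem connCoeff_skew (α β : Fin 2) (A : Option (Fin 4)) :
    c.connCoeff α β A + Complex.conjCLE (c.connCoeff β α A) = 0 := by
  have d : ∀ A C, c A A C = 0 := fun A C => by have := h.anti A A C; linarith
  have j01 := h.jacobi none (some 0) (some 1)
  have j02 := h.jacobi none (some 0) (some 2)
  have j03 := h.jacobi none (some 0) (some 3)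
  have j12 := h.jacobi none (some 1) (some 2)
  have j13 := h.jacobi none (some 1) (some 3)
  have j23 := h.jacobi none (some 2) (some 3)
  have a := fun b => h.anti (some b) none
  simp only [Fin.sum_univ_four, leviFull, leviMatrix, a] at j01 j02 j03 j12 j13 j23
  simp at j01 j02 j03 j12 j13 j23
  rcases A with _ | a
  · fin_cases α <;> fin_cases β <;> apply Complex.ext <;>
      simp [StructureConstants.connCoeff, StructureConstants.complexBr] <;> linarith
  · fin_cases a <;> simp [StructureConstants.connCoeff] <;> ring

/-- Since τ^β is of type (0,1), the condition amounts to the symmetry `key` of its coefficients,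
which again follows from the invariance of dθ under T. -/
theorem torsCoeff_symm (A B : Option (Fin 4)) :
    ∑ β, (Complex.conjCLE (c.torsCoeff β A) * thetaFrame β B
      - Complex.conjCLE (c.torsCoeff β B) * thetaFrame β A) = 0 := by
  have j01 := h.jacobi none (some 0) (some 1)
  have j03 := h.jacobi none (some 0) (some 3)
  have j12 := h.jacobi none (some 1) (some 2)
  have j23 := h.jacobi none (some 2) (some 3)
  have a := fun b => h.anti (some b) none
  simp only [Fin.sum_univ_four, leviFull, leviMatrix, a] at j01 j03 j12 j23
  simp at j01 j03 j12 j23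
  have key : c.reebBr 0 1 = c.reebBr 1 0 := by
    apply Complex.ext <;>
      simp [StructureConstants.reebBr, StructureConstants.complexBr] <;> linarith
  have hI : Complex.I * Complex.I = -1 := Complex.I_mul_I
  rcases A with _ | a <;> rcases B with _ | b
  · simp
  · fin_cases b <;> simp [StructureConstants.torsCoeff, thetaFrame]
  · fin_cases a <;> simp [StructureConstants.torsCoeff, thetaFrame]
  · fin_cases a <;> fin_cases b <;> simp [StructureConstants.torsCoeff, thetaFrame, key] <;>
      grind

-- By type: on (Z, conj Z) the equation holds by the choice of the coefficients; on (conj Z, conj Z)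
-- it is integrability; on (Z, Z) it is d(dθ) = 0 on ξ. In the real frame these three mix, and each
-- real or imaginary part is a linear consequence of them.
set_option maxHeartbeats 1000000 in
theorem structure_eq_of_lt (β : Fin 2) {a b : Fin 4} (hab : a < b) :
    -c.complexBr β (some a) (some b) = ∑ α, (thetaFrame α (some a) * c.connCoeff α β (some b)
      - thetaFrame α (some b) * c.connCoeff α β (some a)) := by
  have d : ∀ A C, c A A C = 0 := fun A C => by have := h.anti A A C; linarith
  have a10 := h.anti (some 1) (some 0)
  have a20 := h.anti (some 2) (some 0)
  have a30 := h.anti (some 3) (some 0)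
  have a21 := h.anti (some 2) (some 1)
  have a31 := h.anti (some 3) (some 1)
  have a32 := h.anti (some 3) (some 2)
  have i0 := h.integrable_zero
  have i1 := h.integrable_one
  have i2 := h.integrable_two
  have i3 := h.integrable_three
  have j012 := h.jacobi (some 0) (some 1) (some 2)
  have j013 := h.jacobi (some 0) (some 1) (some 3)
  have j023 := h.jacobi (some 0) (some 2) (some 3)
  have j123 := h.jacobi (some 1) (some 2) (some 3)
  simp only [Fin.sum_univ_four, leviFull, leviMatrix, a20, a30, a21, a31]
    at j012 j013 j023 j123 i0 i1 i2 i3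
  simp at j012 j013 j023 j123
  fin_cases a <;> fin_cases b <;> first | exact absurd hab (by decide) | skip
  all_goals
    fin_cases β <;> apply Complex.ext <;>
      simp [StructureConstants.connCoeff, thetaFrame,
        StructureConstants.complexBr, StructureConstants.mixedBr, a10, a20, a30, a21, a31, a32, d]
      <;> linarith

theorem structure_eq (β : Fin 2) (A B : Option (Fin 4)) :
    -c.complexBr β A B = ∑ α, (thetaFrame α A * c.connCoeff α β B
      - thetaFrame α B * c.connCoeff α β A)
      + ((if A = none then 1 else 0) * c.torsCoeff β B
        - (if B = none then 1 else 0) * c.torsCoeff β A) := by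
  have d : ∀ A C, c A A C = 0 := fun A C => by have := h.anti A A C; linarith
  have r := fun b => h.anti (some b) none
  rcases A with _ | a <;> rcases B with _ | b
  · simp [StructureConstants.complexBr, d, StructureConstants.torsCoeff]
  · fin_cases b <;> fin_cases β <;> apply Complex.ext <;>
      simp [StructureConstants.connCoeff, StructureConstants.torsCoeff, thetaFrame,
        StructureConstants.complexBr, StructureConstants.reebBr] <;> ring
  · fin_cases a <;> fin_cases β <;> apply Complex.ext <;>
      simp [StructureConstants.connCoeff, StructureConstants.torsCoeff, thetaFrame,
        StructureConstants.complexBr, StructureConstants.reebBr, r] <;> ring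
  · simp only [reduceCtorEq, if_false, zero_mul, sub_zero, add_zero]
    rcases lt_trichotomy a b with hab | rfl | hab
    · exact h.structure_eq_of_lt β hab
    · simp [StructureConstants.complexBr, d]
    · have := h.structure_eq_of_lt β hab
      have e : c.complexBr β (some a) (some b) = -c.complexBr β (some b) (some a) := by
        simp only [StructureConstants.complexBr, h.anti (some a) (some b), map_neg]
        ring
      simp only [Fin.sum_univ_two] at this ⊢
      rw [e]
      linear_combination -this

end StructureConstants.Admissible
end ConnectionAlgebra

/-! ### From the pointwise solution to smooth connection forms -/

section ConnectionExistence

variable {M : Type*} [TopologicalSpace M] [ChartedSpace (EuclideanSpace ℝ (Fin 5)) M]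

theorem SmoothFun.const_mul {f : M → ℂ} {U : Set M} (a : ℂ) (hf : SmoothFun f U) :
    SmoothFun (fun y => a * f y) U :=
  hf.clm (ContinuousLinearMap.mul ℝ ℂ a)

theorem SmoothFun.conj {f : M → ℂ} {U : Set M} (hf : SmoothFun f U) :
    SmoothFun (fun y => Complex.conjCLE (f y)) U :=
  hf.clm (Complex.conjCLE : ℂ →L[ℝ] ℂ)

theorem SmoothFun.add {f g : M → ℂ} {U : Set M} (hf : SmoothFun f U) (hg : SmoothFun g U) :
    SmoothFun (fun y => f y + g y) U :=
  ContMDiffOn.add hf hg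

theorem SmoothFun.sub {f g : M → ℂ} {U : Set M} (hf : SmoothFun f U) (hg : SmoothFun g U) :
    SmoothFun (fun y => f y - g y) U :=
  ContMDiffOn.sub hf hg

theorem smooth_connCoeff {c : M → StructureConstants} {U : Set M}
    (hc : ∀ A B C, SmoothFun (fun x => c x A B C) U) (α β : Fin 2) (A : Option (Fin 4)) :
    SmoothFun (fun x => (c x).connCoeff α β A) U := by
  have h1 : ∀ β A B, SmoothFun (fun x => (c x).complexBr β A B) U := fun β A B =>
    ((hc _ _ _).clm Complex.ofRealCLM).add (((hc _ _ _).clm Complex.ofRealCLM).const_mul _)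
  have h2 : ∀ α γ β, SmoothFun (fun x => (c x).mixedBr α γ β) U := fun α γ β =>
    SmoothFun.const_mul _ ((((h1 _ _ _).add ((h1 _ _ _).const_mul _)).sub
      ((h1 _ _ _).const_mul _)).add (h1 _ _ _))
  rcases A with _ | a
  · exact SmoothFun.const_mul _ ((h1 _ _ _).sub ((h1 _ _ _).const_mul _))
  · fin_cases a
    · exact (h2 _ _ _).conj.sub (h2 _ _ _)
    · exact (h2 _ _ _).conj.sub (h2 _ _ _)
    · exact ((h2 _ _ _).conj.add (h2 _ _ _)).const_mul _
    · exact ((h2 _ _ _).conj.add (h2 _ _ _)).const_mul _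

theorem smooth_torsCoeff {c : M → StructureConstants} {U : Set M}
    (hc : ∀ A B C, SmoothFun (fun x => c x A B C) U) (β : Fin 2) (A : Option (Fin 4)) :
    SmoothFun (fun x => (c x).torsCoeff β A) U := by
  have h1 : ∀ β A B, SmoothFun (fun x => (c x).complexBr β A B) U := fun β A B =>
    ((hc _ _ _).clm Complex.ofRealCLM).add (((hc _ _ _).clm Complex.ofRealCLM).const_mul _)
  have h2 : ∀ β α, SmoothFun (fun x => (c x).reebBr β α) U := fun β α =>
    SmoothFun.const_mul _ ((h1 _ _ _).add ((h1 _ _ _).const_mul _))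
  rcases A with _ | a
  · exact contMDiffOn_const
  · fin_cases a
    · exact h2 _ _
    · exact h2 _ _
    · exact (h2 _ _).const_mul _
    · exact (h2 _ _).const_mul _

variable [IsManifold (𝓡 5) ∞ M] {P : PseudohermitianStructure M}

namespace AdaptedFrame

variable (F : AdaptedFrame P)

/-- The structure constants of the frame at `x`. -/
def structureConstants (x : M) : StructureConstants := fun A B C => F.br A B C x

variable {F}

theorem sum_br_mul_br_none {x : M} (hx : x ∈ F.U) (A B C : Option (Fin 4)) :
    ∑ E, F.br B C E x * F.br A E none x = -∑ d, F.br B C (some d) x * leviFull A d := by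
  rw [Fintype.sum_option, F.br_anti A none, br_reeb hx, neg_zero, mul_zero, zero_add,
    ← Finset.sum_neg_distrib]
  refine Finset.sum_congr rfl fun d _ => ?_
  rcases A with _ | a
  · simp [br_reeb hx, leviFull]
  · simp [br_none hx, leviFull]

theorem admissible {x : M} (hx : x ∈ F.U) : (F.structureConstants x).Admissible where
  anti A B C := F.br_anti A B C x
  jacobi A B C := by
    have h := F.jacobi hx A B C none
    simp only [dirDeriv_br_none hx, sum_br_mul_br_none hx, zero_add] at h
    simp only [structureConstants]
    linear_combination -h
  integrable_zero := (integrable_frame hx).2.1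
  integrable_one := (integrable_frame hx).2.2.1
  integrable_two := (integrable_frame hx).2.2.2.1
  integrable_three := (integrable_frame hx).2.2.2.2

variable (F) in
/-- The complex one-form with the values `f A` on the frame. -/
def formOfValues (f : Option (Fin 4) → M → ℂ) : OneForm M ℂ :=
  fun x => ∑ A, (F.dual A x).smulRight (f A x)

theorem formOfValues_apply (f : Option (Fin 4) → M → ℂ) (x : M) (v : TangentSpace (𝓡 5) x) :
    F.formOfValues f x v = ∑ A, F.dual A x v • f A x := by
  simp only [formOfValues, sum_apply, ContinuousLinearMap.smulRight_apply]

theorem formOfValues_full (f : Option (Fin 4) → M → ℂ) {x : M} (hx : x ∈ F.U)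
    (A : Option (Fin 4)) : F.formOfValues f x (F.full A x) = f A x := by
  rw [formOfValues_apply]
  simp [dual_full hx, -Fintype.sum_option]

theorem smooth_formOfValues {f : Option (Fin 4) → M → ℂ} (hf : ∀ A, SmoothFun (f A) F.U) :
    OneForm.SmoothOn (F.formOfValues f) F.U := by
  intro V hV hVU X hX
  simp only [formOfValues_apply]
  refine contMDiffOn_finsetSum fun A _ => ?_
  exact (F.smooth_dual A V hV hVU X hX).smul ((hf A).mono hVU)

theorem thetaC_full {x : M} (hx : x ∈ F.U) (β : Fin 2) (A : Option (Fin 4)) :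
    F.thetaC β x (F.full A x) = thetaFrame β A := by
  have h : ∀ a, F.coframe a x (F.full A x) = if some a = A then 1 else 0 :=
    fun a => dual_full hx (some a) A
  simp only [thetaC, thetaFrame, OneForm.toComplex, add_apply, smul_apply,
    ContinuousLinearMap.comp_apply, h]
  split_ifs <;> simp

theorem extD_thetaC {x : M} (hx : x ∈ F.U) (β : Fin 2) (A B : Option (Fin 4)) :
    extD (F.thetaC β) (F.full A) (F.full B) x = -(F.structureConstants x).complexBr β A B := by
  unfold extD
  rw [dirDeriv_eq_zero _ _ F.isOpen_U (fun y hy => thetaC_full hy β B) hx,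
    dirDeriv_eq_zero _ _ F.isOpen_U (fun y hy => thetaC_full hy β A) hx]
  simp [thetaC, OneForm.toComplex, StructureConstants.complexBr, structureConstants, br, dual]

theorem toComplex_θ_full {x : M} (hx : x ∈ F.U) (A : Option (Fin 4)) :
    P.θ.toComplex x (F.full A x) = if A = none then 1 else 0 := by
  have h := dual_full hx none A
  simp only [dual] at h
  simp only [OneForm.toComplex, ContinuousLinearMap.comp_apply, h]
  rcases A with _ | a <;> simp

/-- Existence of the pseudohermitian connection in an adapted frame. -/
theorem exists_connection (F : AdaptedFrame P) : ∃ Γ, IsPseudohermitianConnection F Γ := by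
  refine ⟨⟨fun α β => F.formOfValues fun A x => (F.structureConstants x).connCoeff α β A,
    fun β => F.formOfValues fun A x => (F.structureConstants x).torsCoeff β A⟩,
    fun α β => smooth_formOfValues fun A => smooth_connCoeff F.smooth_br α β A,
    fun β => smooth_formOfValues fun A => smooth_torsCoeff F.smooth_br β A, ?_, ?_, ?_⟩
  · intro β A B x hx
    simp only [extD_thetaC hx, wedge, thetaC_full hx, formOfValues_full _ hx, toComplex_θ_full hx]
    exact (admissible hx).structure_eq β A B
  · intro α β x hx v
    simp only [OneForm.conj, ContinuousLinearMap.comp_apply, formOfValues_apply, map_sum,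
      ← Finset.sum_add_distrib]
    refine Finset.sum_eq_zero fun A _ => ?_
    have h := (admissible hx).connCoeff_skew α β A
    simp only [ContinuousLinearEquiv.coe_coe, map_smul, ← smul_add, h, smul_zero]
  · intro A B x hx
    simp only [wedge, OneForm.conj, ContinuousLinearMap.comp_apply, formOfValues_full _ hx,
      thetaC_full hx]
    exact (admissible hx).torsCoeff_symm A B

/-- Existence is all that `Classical.epsilon` needs in order to return a solution; from here on only
the structure equations are used, not the explicit formulas. -/
theorem isPseudohermitianConnection_forms (F : AdaptedFrame P) :
    IsPseudohermitianConnection F F.forms :=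
  Classical.epsilon_spec F.exists_connection

end AdaptedFrame

end ConnectionExistence

/-! ### Symmetries of curvature and torsion -/

section Bianchi

variable {M : Type*} [TopologicalSpace M] [ChartedSpace (EuclideanSpace ℝ (Fin 5)) M]
  [IsManifold (𝓡 5) ∞ M] {P : PseudohermitianStructure M}

namespace AdaptedFrame

variable (F : AdaptedFrame P)

/-- The functions `θ_α^β(A)` for the members `A` of the frame. -/
def connFun (α β : Fin 2) (A : Option (Fin 4)) (x : M) : ℂ := F.connC α β x (F.full A x)

/-- The functions `τ^β(A)` for the members `A` of the frame. -/
def torsFun (β : Fin 2) (A : Option (Fin 4)) (x : M) : ℂ := F.forms.tors β x (F.full A x)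

theorem smooth_connFun (α β : Fin 2) (A : Option (Fin 4)) : SmoothFun (F.connFun α β A) F.U :=
  F.isPseudohermitianConnection_forms.smooth_conn α β F.U F.isOpen_U subset_rfl _ (F.smooth_full A)

variable {F}

theorem connC_apply {x : M} (hx : x ∈ F.U) (α β : Fin 2) (v : TangentSpace (𝓡 5) x) :
    F.connC α β x v = ∑ A, (F.dual A x v : ℂ) * F.connFun α β A x := by
  conv_lhs => rw [expand hx v]
  simp only [map_sum, map_smul, connFun, Complex.real_smul]

theorem connC_skew {x : M} (hx : x ∈ F.U) (α β : Fin 2) (v : TangentSpace (𝓡 5) x) :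
    F.connC α β x v = -(starRingEnd ℂ) (F.connC β α x v) :=
  eq_neg_of_add_eq_zero_left (F.isPseudohermitianConnection_forms.skew α β x hx v)

theorem complexBr_eq {x : M} (hx : x ∈ F.U) (β : Fin 2) (A B : Option (Fin 4)) :
    (F.structureConstants x).complexBr β A B =
      -(∑ α, (thetaFrame α A * F.connFun α β B x - thetaFrame α B * F.connFun α β A x)
      + ((if A = none then 1 else 0) * F.torsFun β B x
        - (if B = none then 1 else 0) * F.torsFun β A x)) := by
  have h := F.isPseudohermitianConnection_forms.structure_eq β A B x hx
  simp only [extD_thetaC hx, wedge, thetaC_full hx, toComplex_θ_full hx] at h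
  exact neg_eq_iff_eq_neg.1 h

theorem complexBr_horizontal {x : M} (hx : x ∈ F.U) (β : Fin 2) (a b : Fin 4) :
    (F.structureConstants x).complexBr β (some a) (some b) =
      ∑ α, (thetaFrame α (some b) * F.connFun α β (some a) x
        - thetaFrame α (some a) * F.connFun α β (some b) x) := by
  rw [complexBr_eq hx]
  simp only [reduceCtorEq, if_false, zero_mul, sub_zero, add_zero, ← Finset.sum_neg_distrib,
    neg_sub]

theorem tors_symm_frame {x : M} (hx : x ∈ F.U) (A B : Option (Fin 4)) :
    ∑ β, ((starRingEnd ℂ) (F.torsFun β A x) * thetaFrame β B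
      - (starRingEnd ℂ) (F.torsFun β B x) * thetaFrame β A) = 0 := by
  have h := F.isPseudohermitianConnection_forms.tors_symm A B x hx
  simp only [wedge, thetaC_full hx] at h
  exact h

theorem sum_br_mul_thetaFrame (x : M) (β : Fin 2) (A B : Option (Fin 4)) :
    ∑ E, (F.br A B E x : ℂ) * thetaFrame β E = (F.structureConstants x).complexBr β A B := by
  simp [thetaFrame, mul_add, Finset.sum_add_distrib, StructureConstants.complexBr,
    structureConstants, -Fintype.sum_option, mul_comm]

theorem dirDeriv_linear_combination (X : VField M) {f g : M → ℂ} (a b : ℂ) {x : M} (hx : x ∈ F.U)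
    (hf : SmoothFun f F.U) (hg : SmoothFun g F.U) :
    dirDeriv X (fun y => a * f y + b * g y) x = a * dirDeriv X f x + b * dirDeriv X g x := by
  have hm : ∀ (a : ℂ) {f : M → ℂ}, SmoothFun f F.U →
      dirDeriv X (fun y => a * f y) x = a * dirDeriv X f x := fun a f hf =>
    dirDeriv_clm X (ContinuousLinearMap.mul ℝ ℂ a) (hf.mdifferentiableAt F.isOpen_U hx)
  rw [dirDeriv_add X ((hf.const_mul a).mdifferentiableAt F.isOpen_U hx)
    ((hg.const_mul b).mdifferentiableAt F.isOpen_U hx), hm a hf, hm b hg]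

theorem dirDeriv_complexBr (X : VField M) {x : M} (hx : x ∈ F.U) (β : Fin 2)
    (A B : Option (Fin 4)) :
    dirDeriv X (fun y => (F.structureConstants y).complexBr β A B) x
      = (dirDeriv X (F.br A B (some (idx β))) x : ℝ)
        + Complex.I * (dirDeriv X (F.br A B (some (idxJ β))) x : ℝ) := by
  have e : ∀ D, dirDeriv X (fun y => Complex.ofRealCLM (F.br A B D y)) x
      = ((dirDeriv X (F.br A B D) x : ℝ) : ℂ) := fun D =>
    dirDeriv_clm X Complex.ofRealCLM ((F.smooth_br A B D).mdifferentiableAt F.isOpen_U hx)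
  have h := dirDeriv_linear_combination X 1 Complex.I hx
    ((F.smooth_br A B (some (idx β))).clm Complex.ofRealCLM)
    ((F.smooth_br A B (some (idxJ β))).clm Complex.ofRealCLM)
  simp only [e, one_mul] at h
  exact h

theorem dirDeriv_complexBr_horizontal (X : VField M) {x : M} (hx : x ∈ F.U) (β : Fin 2)
    (a b : Fin 4) :
    dirDeriv X (fun y => (F.structureConstants y).complexBr β (some a) (some b)) x
      = ∑ α, (thetaFrame α (some b) * dirDeriv X (F.connFun α β (some a)) x
        - thetaFrame α (some a) * dirDeriv X (F.connFun α β (some b)) x) := by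
  have s := F.smooth_connFun
  have h : ∀ α, SmoothFun (fun y => thetaFrame α (some b) * F.connFun α β (some a) y
        + -thetaFrame α (some a) * F.connFun α β (some b) y) F.U := fun α =>
    ((s α β _).const_mul _).add ((s α β _).const_mul _)
  rw [dirDeriv_congr X F.isOpen_U (fun y hy => complexBr_horizontal hy β a b) hx]
  simp only [sub_eq_add_neg, ← neg_mul]
  rw [(dirDeriv_sum X Finset.univ fun α _ => (h α).mdifferentiableAt F.isOpen_U hx).1]
  exact Finset.sum_congr rfl fun α _ =>
    dirDeriv_linear_combination X _ _ hx (s α β _) (s α β _)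

/-- The ω^β-component of the Jacobi identity plus i times its ω^{2+β}-component. -/
theorem complex_jacobi {x : M} (hx : x ∈ F.U) (β : Fin 2) (A B C : Option (Fin 4)) :
    (dirDeriv (F.full A) (fun y => (F.structureConstants y).complexBr β B C) x
      + ∑ E, (F.br B C E x : ℂ) * (F.structureConstants x).complexBr β A E)
    + (dirDeriv (F.full B) (fun y => (F.structureConstants y).complexBr β C A) x
      + ∑ E, (F.br C A E x : ℂ) * (F.structureConstants x).complexBr β B E)
    + (dirDeriv (F.full C) (fun y => (F.structureConstants y).complexBr β A B) x
      + ∑ E, (F.br A B E x : ℂ) * (F.structureConstants x).complexBr β C E) = 0 := by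
  have h1 := congrArg (fun r : ℝ => (r : ℂ)) (F.jacobi hx A B C (some (idx β)))
  have h2 := congrArg (fun r : ℝ => (r : ℂ)) (F.jacobi hx A B C (some (idxJ β)))
  have e : ∀ A B C, ∑ E, (F.br B C E x : ℂ) * (F.structureConstants x).complexBr β A E
      = ∑ E, (F.br B C E x : ℂ) * (F.br A E (some (idx β)) x : ℂ)
        + Complex.I * ∑ E, (F.br B C E x : ℂ) * (F.br A E (some (idxJ β)) x : ℂ) := by
    intro A B C
    rw [Finset.mul_sum, ← Finset.sum_add_distrib]
    refine Finset.sum_congr rfl fun E _ => ?_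
    simp only [StructureConstants.complexBr, structureConstants, Complex.ofRealCLM_apply]
    ring
  simp only [Complex.ofReal_add, Complex.ofReal_sum, Complex.ofReal_mul, Complex.ofReal_zero]
    at h1 h2
  simp only [dirDeriv_complexBr _ hx, e]
  linear_combination h1 + Complex.I * h2

/-- The quadratic terms of the Jacobi identity, rewritten by the structure equations: the first sum
feeds θ ∧ θ in the curvature, the second the bracket term of dθ_α^β, and the T-component of [e_b,
e_c] brings in the torsion. -/
theorem sum_br_mul_complexBr {x : M} (hx : x ∈ F.U) (β : Fin 2) (a b c : Fin 4) :
    ∑ E, (F.br (some b) (some c) E x : ℂ) * (F.structureConstants x).complexBr β (some a) E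
      = ∑ α, (F.structureConstants x).complexBr α (some b) (some c) * F.connFun α β (some a) x
        - ∑ α, thetaFrame α (some a)
            * ∑ E, (F.br (some b) (some c) E x : ℂ) * F.connFun α β E x
        + F.br (some b) (some c) none x * F.torsFun β (some a) x := by
  simp only [← sum_br_mul_thetaFrame x _ (some b) (some c)]
  simp only [complexBr_eq hx, Fin.sum_univ_two, Fintype.sum_option, Fin.sum_univ_four, thetaFrame]
  simp
  ring

variable (F) in
/-- The curvature form `Ω_α^β(e_a, e_b)`. -/
def curvFrame (x : M) (α β : Fin 2) (a b : Fin 4) : ℂ := F.curvForm α β (F.e a) (F.e b) x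

theorem extD_connC {x : M} (hx : x ∈ F.U) (α β : Fin 2) (A B : Option (Fin 4)) :
    extD (F.connC α β) (F.full A) (F.full B) x
      = dirDeriv (F.full A) (F.connFun α β B) x - dirDeriv (F.full B) (F.connFun α β A) x
        - ∑ E, (F.br A B E x : ℂ) * F.connFun α β E x := by
  unfold extD
  rw [connC_apply hx]
  rfl

theorem curvFrame_eq {x : M} (hx : x ∈ F.U) (α β : Fin 2) (a b : Fin 4) :
    F.curvFrame x α β a b
      = dirDeriv (F.e a) (F.connFun α β (some b)) x - dirDeriv (F.e b) (F.connFun α β (some a)) x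
        - ∑ E, (F.br (some a) (some b) E x : ℂ) * F.connFun α β E x
        - ∑ γ, (F.connFun α γ (some a) x * F.connFun γ β (some b) x
          - F.connFun α γ (some b) x * F.connFun γ β (some a) x) := by
  unfold curvFrame curvForm
  have h := extD_connC hx α β (some a) (some b)
  simp only [full] at h
  rw [h]
  rfl

/-- The first Bianchi identity of the pseudohermitian connection on `ξ`. -/
theorem bianchi {x : M} (hx : x ∈ F.U) (β : Fin 2) (a b c : Fin 4) :
    ∑ α, (thetaFrame α (some a) * F.curvFrame x α β b c
      + thetaFrame α (some b) * F.curvFrame x α β c a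
      + thetaFrame α (some c) * F.curvFrame x α β a b)
      = leviMatrix b c * F.torsFun β (some a) x + leviMatrix c a * F.torsFun β (some b) x
        + leviMatrix a b * F.torsFun β (some c) x := by
  -- This is d(dθ^β) = 0. Its connection terms assemble into the curvature forms, and the
  -- T-components of the brackets produce dθ ∧ τ^β.
  have h := complex_jacobi hx β (some a) (some b) (some c)
  simp only [sum_br_mul_complexBr hx, dirDeriv_complexBr_horizontal _ hx, complexBr_horizontal hx,
    br_none hx, Fin.sum_univ_two] at h
  simp only [curvFrame_eq hx, Fin.sum_univ_two]
  simp only [full, Complex.ofReal_neg] at h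
  linear_combination h

theorem curvFrame_anti (x : M) (α β : Fin 2) (a b : Fin 4) :
    F.curvFrame x α β a b = -F.curvFrame x α β b a := by
  unfold curvFrame curvForm extD
  rw [VectorField.mlieBracket_swap_apply, map_neg]
  simp only [wedge, Fin.sum_univ_two]
  ring

theorem dirDeriv_connFun_skew (X : VField M) {x : M} (hx : x ∈ F.U) (α β : Fin 2)
    (A : Option (Fin 4)) :
    dirDeriv X (F.connFun α β A) x = -(starRingEnd ℂ) (dirDeriv X (F.connFun β α A) x) := by
  rw [dirDeriv_congr X F.isOpen_U (f := F.connFun α β A)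
    (g := fun y => (-(Complex.conjCLE : ℂ →L[ℝ] ℂ)) (F.connFun β α A y))
    (fun y hy => connC_skew hy α β _) hx,
    dirDeriv_clm X _ ((F.smooth_connFun β α A).mdifferentiableAt F.isOpen_U hx)]
  rfl

theorem curvFrame_skew {x : M} (hx : x ∈ F.U) (α β : Fin 2) (a b : Fin 4) :
    F.curvFrame x α β a b = -(starRingEnd ℂ) (F.curvFrame x β α a b) := by
  have hs : ∀ α β A, (starRingEnd ℂ) (F.connFun α β A x) = -F.connFun β α A x := fun α β A => by
    rw [connFun, connC_skew hx α β, map_neg, Complex.conj_conj]; rfl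
  have hd : ∀ X α β A, (starRingEnd ℂ) (dirDeriv X (F.connFun α β A) x)
      = -dirDeriv X (F.connFun β α A) x := fun X α β A => by
    rw [dirDeriv_connFun_skew X hx α β, map_neg, Complex.conj_conj]
  simp only [curvFrame_eq hx, map_sub, map_sum, map_mul, Complex.conj_ofReal, hd, hs,
    map_add, Fin.sum_univ_two, mul_neg, Finset.sum_neg_distrib]
  ring

/-- The condition ∑ conj τ^β ∧ θ^β = 0 makes τ^β on ξ a form of type (0,1) with symmetric
coefficients. -/
theorem torsFun_symm {x : M} (hx : x ∈ F.U) :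
    F.torsFun 0 (some 1) x = F.torsFun 1 (some 0) x ∧
    F.torsFun 0 (some 2) x = -Complex.I * F.torsFun 0 (some 0) x ∧
    F.torsFun 0 (some 3) x = -Complex.I * F.torsFun 0 (some 1) x ∧
    F.torsFun 1 (some 2) x = -Complex.I * F.torsFun 1 (some 0) x ∧
    F.torsFun 1 (some 3) x = -Complex.I * F.torsFun 1 (some 1) x := by
  have h := fun a b => congrArg (starRingEnd ℂ) (tors_symm_frame hx (some a) (some b))
  have h01 := h 0 1
  have h02 := h 0 2
  have h03 := h 0 3
  have h12 := h 1 2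
  have h13 := h 1 3
  simp [Fin.sum_univ_two, thetaFrame] at h01 h02 h03 h12 h13
  exact ⟨by linear_combination -h01, by linear_combination -h02,
    by linear_combination -h03 - Complex.I * h01, by linear_combination -h12 + Complex.I * h01,
    by linear_combination -h13⟩

end AdaptedFrame

end Bianchi

/-! ### Clifford algebra and the spin representation on S⁺ -/

section SpinAlgebra

/-- The real `4 × 4` matrix of the complex `2 × 2` matrix `u`, in the basis `e_1, e_2, Je_1, Je_2`. -/
def realify (u : Fin 2 → Fin 2 → ℂ) (a b : Fin 4) : ℝ :=
  match a, b with
  | 0, 0 => (u 0 0).re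
  | 0, 1 => (u 0 1).re
  | 0, 2 => (u 0 0).im
  | 0, 3 => (u 0 1).im
  | 1, 0 => (u 1 0).re
  | 1, 1 => (u 1 1).re
  | 1, 2 => (u 1 0).im
  | 1, 3 => (u 1 1).im
  | 2, 0 => -(u 0 0).im
  | 2, 1 => -(u 0 1).im
  | 2, 2 => (u 0 0).re
  | 2, 3 => (u 0 1).re
  | 3, 0 => -(u 1 0).im
  | 3, 1 => -(u 1 1).im
  | 3, 2 => (u 1 0).re
  | 3, 3 => (u 1 1).re

/-- Linearity, smoothness and derivatives pass from complex to real matrix entries through this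
form, without sixteen cases each time. -/
theorem exists_realify_eq (a b : Fin 4) : ∃ (α β : Fin 2) (L : ℂ →L[ℝ] ℝ),
    ∀ u, realify u a b = L (u α β) := by
  fin_cases a <;> fin_cases b
  · exact ⟨0, 0, Complex.reCLM, fun _ => rfl⟩
  · exact ⟨0, 1, Complex.reCLM, fun _ => rfl⟩
  · exact ⟨0, 0, Complex.imCLM, fun _ => rfl⟩
  · exact ⟨0, 1, Complex.imCLM, fun _ => rfl⟩
  · exact ⟨1, 0, Complex.reCLM, fun _ => rfl⟩
  · exact ⟨1, 1, Complex.reCLM, fun _ => rfl⟩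
  · exact ⟨1, 0, Complex.imCLM, fun _ => rfl⟩
  · exact ⟨1, 1, Complex.imCLM, fun _ => rfl⟩
  · exact ⟨0, 0, -Complex.imCLM, fun _ => rfl⟩
  · exact ⟨0, 1, -Complex.imCLM, fun _ => rfl⟩
  · exact ⟨0, 0, Complex.reCLM, fun _ => rfl⟩
  · exact ⟨0, 1, Complex.reCLM, fun _ => rfl⟩
  · exact ⟨1, 0, -Complex.imCLM, fun _ => rfl⟩
  · exact ⟨1, 1, -Complex.imCLM, fun _ => rfl⟩
  · exact ⟨1, 0, Complex.reCLM, fun _ => rfl⟩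
  · exact ⟨1, 1, Complex.reCLM, fun _ => rfl⟩

/-- Skew-Hermitian matrices. -/
def IsSkew (u : Fin 2 → Fin 2 → ℂ) : Prop := ∀ α β, u α β = -(starRingEnd ℂ) (u β α)

theorem IsSkew.eqs {u : Fin 2 → Fin 2 → ℂ} (hu : IsSkew u) : (u 0 0).re = 0 ∧ (u 1 1).re = 0 ∧
    (u 1 0).re = -(u 0 1).re ∧ (u 1 0).im = (u 0 1).im := by
  have h := fun α β => congrArg Complex.re (hu α β)
  have h' := fun α β => congrArg Complex.im (hu α β)
  have h0 := h 0 0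
  have h1 := h 1 1
  have h2 := h 1 0
  have h3 := h' 1 0
  simp at h0 h1 h2 h3
  exact ⟨by linarith, by linarith, h2, h3⟩

theorem realify_skew {u : Fin 2 → Fin 2 → ℂ} (hu : IsSkew u) (a b : Fin 4) :
    realify u a b = -realify u b a := by
  obtain ⟨h0, h1, h2, h3⟩ := hu.eqs
  fin_cases a <;> fin_cases b <;> simp [realify, h0, h1, h2, h3]

/-- The spin representation of `𝔲(2) ⊆ 𝔰𝔬(4)`: `u ↦ ¼ ∑ u_{ab} e_a e_b`. -/
def spinRep : (Fin 2 → Fin 2 → ℂ) →ₗ[ℝ] Module.End ℂ (Spinor 2) where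
  toFun u := (1 / 4 : ℝ) • ∑ a, ∑ b, realify u a b • (cliffordE a * cliffordE b)
  map_add' u v := by
    have h : ∀ a b, realify (u + v) a b = realify u a b + realify v a b := fun a b => by
      obtain ⟨α, β, L, hL⟩ := exists_realify_eq a b
      simp [hL]
    simp only [h, add_smul, Finset.sum_add_distrib, smul_add]
  map_smul' c u := by
    have h : ∀ a b, realify (c • u) a b = c * realify u a b := fun a b => by
      obtain ⟨α, β, L, hL⟩ := exists_realify_eq a b
      rw [hL, hL, Pi.smul_apply, Pi.smul_apply, map_smul, smul_eq_mul]
    simp only [h, mul_smul, ← Finset.smul_sum, RingHom.id_apply]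
    rw [smul_comm]

theorem cliffordE_eq (a : Fin 4) : cliffordE a = cliffordVec (Pi.single a 1) := by
  change _ = ∑ b, (Pi.single a (1 : ℝ) : Fin 4 → ℝ) b • cliffordE b
  simp [Pi.single_apply]

theorem cliffordE_apply (f : Spinor 2) :
    (cliffordE 0 f ∅ = -f {0} ∧ cliffordE 0 f {0} = f ∅ ∧ cliffordE 0 f {1} = -f {0, 1} ∧
      cliffordE 0 f {0, 1} = f {1}) ∧
    (cliffordE 1 f ∅ = Complex.I * f {0} ∧ cliffordE 1 f {0} = Complex.I * f ∅ ∧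
      cliffordE 1 f {1} = Complex.I * f {0, 1} ∧ cliffordE 1 f {0, 1} = Complex.I * f {1}) ∧
    (cliffordE 2 f ∅ = -f {1} ∧ cliffordE 2 f {0} = f {0, 1} ∧ cliffordE 2 f {1} = f ∅ ∧
      cliffordE 2 f {0, 1} = -f {0}) ∧
    (cliffordE 3 f ∅ = Complex.I * f {1} ∧ cliffordE 3 f {0} = -Complex.I * f {0, 1} ∧
      cliffordE 3 f {1} = Complex.I * f ∅ ∧ cliffordE 3 f {0, 1} = -Complex.I * f {0}) := by
  simp [cliffordE_eq, cliffordVec_apply]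

theorem spinor_ext {f g : Spinor 2} (h0 : f ∅ = g ∅) (h1 : f {0} = g {0}) (h2 : f {1} = g {1})
    (h3 : f {0, 1} = g {0, 1}) : f = g := by
  funext K
  rcases finset_fin_two_cases K with rfl | rfl | rfl | rfl <;> assumption

theorem mem_positiveSpinors {f : Spinor 2} : f ∈ positiveSpinors ↔ f {0} = 0 ∧ f {1} = 0 := by
  constructor
  · exact fun h => ⟨h {0} (by decide), h {1} (by decide)⟩
  · intro h K hK
    rcases finset_fin_two_cases K with rfl | rfl | rfl | rfl
    · exact absurd hK (by decide)
    · exact h.1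
    · exact h.2
    · exact absurd hK (by decide)

theorem cliffordE_mul_add (a b : Fin 4) :
    cliffordE a * cliffordE b + cliffordE b * cliffordE a
      = (if a = b then -2 else 0 : ℝ) • (1 : Module.End ℂ (Spinor 2)) := by
  have hI : Complex.I * Complex.I = -1 := Complex.I_mul_I
  refine LinearMap.ext fun f => ?_
  fin_cases a <;> fin_cases b <;> apply spinor_ext <;>
    simp [cliffordE_apply, ← mul_assoc, hI] <;> ring

theorem cliffordE_sq (a : Fin 4) (f : Spinor 2) : cliffordE a (cliffordE a f) = -f := by
  have hI : Complex.I * Complex.I = -1 := Complex.I_mul_I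
  fin_cases a <;> apply spinor_ext <;> simp [cliffordE_apply, ← mul_assoc, hI]

theorem cliffordE_anticomm {a b : Fin 4} (h : a ≠ b) (f : Spinor 2) :
    cliffordE b (cliffordE a f) = -cliffordE a (cliffordE b f) := by
  have h' := LinearMap.congr_fun (cliffordE_mul_add a b) f
  rw [if_neg h, zero_smul] at h'
  exact eq_neg_of_add_eq_zero_right h'

/-- On S⁺ the volume element E_1E_2E_3E_4 acts by -1. Hence (E_1E_3)(E_2E_4) = 1 there, and since
(E_1E_3)² = -1 this forces E_2E_4 = -E_1E_3. -/
theorem commute_reeb_positive {s : Spinor 2} (hs : s ∈ positiveSpinors) :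
    (cliffordE 0 * cliffordE 2 + cliffordE 1 * cliffordE 3) s = 0 := by
  obtain ⟨h0, h1⟩ := mem_positiveSpinors.1 hs
  have hI : Complex.I * Complex.I = -1 := Complex.I_mul_I
  apply spinor_ext <;> simp [cliffordE_apply, ← mul_assoc, hI, h0, h1]

section CliffordRelations

variable {A : Type*} [Ring A] [Algebra ℝ A] {E : Fin 4 → A}

theorem triple_of_clifford
    (hE : ∀ a b, E a * E b + E b * E a = (if a = b then -2 else 0 : ℝ) • (1 : A)) (a b c : Fin 4) :
    E a * E b * E c - E c * (E a * E b)
      = (if a = c then 2 else 0 : ℝ) • E b + (if b = c then -2 else 0 : ℝ) • E a := by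
  have h1 := congrArg (fun z => E a * z) (hE b c)
  have h2 := congrArg (fun z => z * E b) (hE a c)
  simp only [mul_add, add_mul, smul_mul_assoc, mul_smul_comm, mul_one, one_mul] at h1 h2
  have h3 : (if a = c then (2 : ℝ) else 0) = -(if a = c then -2 else 0) := by split_ifs <;> simp
  rw [h3, neg_smul, ← h1, ← h2]
  noncomm_ring

/-- Each of the two contractions in `triple_of_clifford` contributes 2 ∑ w_cd E_d, the second by
skewness of w; the factor ¼ normalises the total. -/
theorem commutator_of_clifford
    (hE : ∀ a b, E a * E b + E b * E a = (if a = b then -2 else 0 : ℝ) • (1 : A))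
    {w : Fin 4 → Fin 4 → ℝ} (hw : ∀ a b, w a b = -w b a) (c : Fin 4) :
    ((1 / 4 : ℝ) • ∑ a, ∑ b, w a b • (E a * E b)) * E c
      = E c * ((1 / 4 : ℝ) • ∑ a, ∑ b, w a b • (E a * E b)) + ∑ d, w c d • E d := by
  rw [← sub_eq_iff_eq_add']
  simp only [smul_mul_assoc, mul_smul_comm, Finset.sum_mul, Finset.mul_sum, ← smul_sub,
    ← Finset.sum_sub_distrib, triple_of_clifford hE, smul_add, Finset.sum_add_distrib, smul_smul]
  have e1 : ∑ a, ∑ b, (w a b * if a = c then 2 else 0) • E b = (2 : ℝ) • ∑ d, w c d • E d := by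
    rw [Finset.sum_eq_single c (fun a _ h => by simp [h]) (by simp)]
    rw [Finset.smul_sum]
    refine Finset.sum_congr rfl fun b _ => ?_
    rw [if_pos rfl, smul_smul, mul_comm]
  have e2 : ∑ a, ∑ b, (w a b * if b = c then -2 else 0) • E a = (2 : ℝ) • ∑ d, w c d • E d := by
    rw [Finset.smul_sum]
    refine Finset.sum_congr rfl fun a _ => ?_
    rw [Finset.sum_eq_single c (fun a _ h => by simp [h]) (by simp), if_pos rfl, hw a c, smul_smul]
    congr 1
    ring
  rw [e1, e2, smul_smul, ← add_smul]
  norm_num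

end CliffordRelations

/-- The spin representation covers the vector representation. -/
theorem spinRep_commutator {u : Fin 2 → Fin 2 → ℂ} (hu : IsSkew u) (c : Fin 4) (f : Spinor 2) :
    spinRep u (cliffordE c f) = cliffordE c (spinRep u f)
      + ∑ d, realify u c d • cliffordE d f := by
  have h := LinearMap.congr_fun
    (commutator_of_clifford cliffordE_mul_add (realify_skew hu) c) f
  simp only [LinearMap.add_apply, Module.End.mul_apply, LinearMap.sum_apply,
    LinearMap.smul_apply] at h
  simpa [spinRep] using h

/-- Only the trace-free part of u acts on S⁺: the matrix i·1 is sent to ½(E_1E_3 + E_2E_4), which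
vanishes there. So 𝔲(2) acts through 𝔰𝔲(2). -/
theorem spinRep_apply {u : Fin 2 → Fin 2 → ℂ} (hu : IsSkew u) {f : Spinor 2}
    (hf : f ∈ positiveSpinors) :
    spinRep u f ∅ = -Complex.I * (u 0 1).re * f ∅
      + (Complex.I * (u 0 1).im - (1 / 2) * ((u 0 0).im - (u 1 1).im)) * f {0, 1} ∧
    spinRep u f {0} = 0 ∧ spinRep u f {1} = 0 ∧
    spinRep u f {0, 1} = Complex.I * (u 0 1).re * f {0, 1}
      + (Complex.I * (u 0 1).im + (1 / 2) * ((u 0 0).im - (u 1 1).im)) * f ∅ := by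
  obtain ⟨h0, h1⟩ := mem_positiveSpinors.1 hf
  obtain ⟨s0, s1, s2, s3⟩ := hu.eqs
  have hI : Complex.I * Complex.I = -1 := Complex.I_mul_I
  have hs : spinRep u = (1 / 4 : ℝ) • ∑ a, ∑ b, realify u a b • (cliffordE a * cliffordE b) := rfl
  rw [hs]
  refine ⟨?_, ?_, ?_, ?_⟩ <;>
    simp [Fin.sum_univ_four, realify, cliffordE_apply, s0, s1, s2, s3, h0, h1] <;>
    ring_nf <;> simp <;> ring

theorem spinRep_mem {u : Fin 2 → Fin 2 → ℂ} (hu : IsSkew u) {f : Spinor 2}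
    (hf : f ∈ positiveSpinors) : spinRep u f ∈ positiveSpinors :=
  mem_positiveSpinors.2 ⟨(spinRep_apply hu hf).2.1, (spinRep_apply hu hf).2.2.1⟩

theorem IsSkew.commutator {u v : Fin 2 → Fin 2 → ℂ} (hu : IsSkew u) (hv : IsSkew v) :
    IsSkew fun α β => ∑ γ, (u α γ * v γ β - v α γ * u γ β) := by
  intro α β
  simp only [map_sum, map_sub, map_mul, ← Finset.sum_neg_distrib]
  refine Finset.sum_congr rfl fun γ _ => ?_
  rw [hu α γ, hu γ β, hv α γ, hv γ β]
  ring

/-- The minus sign comes from the row convention ∇e_a = ∑ u_ab e_b, which reverses products. It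
matches the sign in the curvature dθ_α^β - θ_α^γ ∧ θ_γ^β. -/
theorem spinRep_bracket {u v : Fin 2 → Fin 2 → ℂ} (hu : IsSkew u) (hv : IsSkew v)
    {f : Spinor 2} (hf : f ∈ positiveSpinors) :
    spinRep u (spinRep v f) - spinRep v (spinRep u f)
      = -spinRep (fun α β => ∑ γ, (u α γ * v γ β - v α γ * u γ β)) f := by
  have hI : Complex.I * Complex.I = -1 := Complex.I_mul_I
  obtain ⟨s0, s1, s2, s3⟩ := hu.eqs
  obtain ⟨t0, t1, t2, t3⟩ := hv.eqs
  have h1 := spinRep_apply hu (spinRep_mem hv hf)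
  have h2 := spinRep_apply hv (spinRep_mem hu hf)
  have h3 := spinRep_apply (hu.commutator hv) hf
  have h4 := spinRep_apply hu hf
  have h5 := spinRep_apply hv hf
  apply spinor_ext
  · simp only [Pi.sub_apply, Pi.neg_apply, h1, h2, h3, h4, h5]
    simp [Fin.sum_univ_two, s0, s1, s2, s3, t0, t1, t2, t3]
    ring_nf
    simp
    ring
  · simp only [Pi.sub_apply, Pi.neg_apply, h1, h2, h3, sub_zero, neg_zero]
  · simp only [Pi.sub_apply, Pi.neg_apply, h1, h2, h3, sub_zero, neg_zero]
  · simp only [Pi.sub_apply, Pi.neg_apply, h1, h2, h3, h4, h5]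
    simp [Fin.sum_univ_two, s0, s1, s2, s3, t0, t1, t2, t3]
    ring_nf
    simp
    ring

end SpinAlgebra

/-! ### The Clifford contraction of the curvature -/

section CurvatureAlgebra

/-- Curvature forms and torsion forms on `ξ`, with the symmetries of the curvature and the torsion
of the pseudohermitian connection. -/
structure IsCurvature (Ω : Fin 2 → Fin 2 → Fin 4 → Fin 4 → ℂ) (t : Fin 2 → Fin 4 → ℂ) : Prop where
  anti : ∀ α β a b, Ω α β a b = -Ω α β b a
  skew : ∀ a b, IsSkew fun α β => Ω α β a b
  bianchi : ∀ β a b c, ∑ α, (thetaFrame α (some a) * Ω α β b c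
      + thetaFrame α (some b) * Ω α β c a + thetaFrame α (some c) * Ω α β a b)
      = leviMatrix b c * t β a + leviMatrix c a * t β b + leviMatrix a b * t β c
  tors : t 0 1 = t 1 0 ∧ t 0 2 = -Complex.I * t 0 0 ∧ t 0 3 = -Complex.I * t 0 1 ∧
    t 1 2 = -Complex.I * t 1 0 ∧ t 1 3 = -Complex.I * t 1 1

/-- The Tanaka–Webster scalar curvature of the curvature forms `Ω`. -/
def websterScalar (Ω : Fin 2 → Fin 2 → Fin 4 → Fin 4 → ℂ) : ℝ :=
  (∑ β, ∑ γ, (1 / 4 : ℂ) * (Ω γ γ (AdaptedFrame.idx β) (AdaptedFrame.idx β)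
    + Complex.I * Ω γ γ (AdaptedFrame.idx β) (AdaptedFrame.idxJ β)
    - Complex.I * Ω γ γ (AdaptedFrame.idxJ β) (AdaptedFrame.idx β)
    + Ω γ γ (AdaptedFrame.idxJ β) (AdaptedFrame.idxJ β))).re

/-- These are the four quaternionic components of the Clifford contraction on S⁺. All are linear
consequences of the real and imaginary parts of the Bianchi identity; the torsion terms cancel
because t is symmetric of type (0,1). The first relation trades the trace-free curvature seen by S⁺
for the trace of Ω that defines W. -/
theorem IsCurvature.relations {Ω : Fin 2 → Fin 2 → Fin 4 → Fin 4 → ℂ} {t : Fin 2 → Fin 4 → ℂ}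
    (h : IsCurvature Ω t) :
    ((Ω 0 1 0 1).re + (Ω 0 1 2 3).re) + ((Ω 0 1 0 3).im + (Ω 0 1 1 2).im)
      + (1 / 2) * (((Ω 0 0 0 2).im - (Ω 1 1 0 2).im) - ((Ω 0 0 1 3).im - (Ω 1 1 1 3).im))
      = -websterScalar Ω ∧
    (Ω 0 1 0 1).im + (Ω 0 1 2 3).im = (Ω 0 1 0 3).re + (Ω 0 1 1 2).re ∧
    (1 / 2) * (((Ω 0 0 0 1).im - (Ω 1 1 0 1).im) + ((Ω 0 0 2 3).im - (Ω 1 1 2 3).im))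
      = (Ω 0 1 0 2).re - (Ω 0 1 1 3).re ∧
    (1 / 2) * (((Ω 0 0 0 3).im - (Ω 1 1 0 3).im) + ((Ω 0 0 1 2).im - (Ω 1 1 1 2).im))
      = (Ω 0 1 0 2).im - (Ω 0 1 1 3).im := by
  have s := fun a b => (h.skew a b).eqs
  obtain ⟨t1, t2, t3, t4, t5⟩ := h.tors
  have anti20 := fun α β => h.anti α β 2 0
  have anti30 := fun α β => h.anti α β 3 0
  have anti31 := fun α β => h.anti α β 3 1
  have d : ∀ α β a, Ω α β a a = 0 := fun α β a => self_eq_neg.1 (h.anti α β a a)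
  have b := fun β a b c => congrArg Complex.re (h.bianchi β a b c)
  have b' := fun β a b c => congrArg Complex.im (h.bianchi β a b c)
  have r1 := b 0 0 1 2
  have r2 := b 0 0 1 3
  have r3 := b 0 0 2 3
  have r4 := b 0 1 2 3
  have r5 := b 1 0 1 2
  have r6 := b 1 0 1 3
  have r7 := b 1 0 2 3
  have r8 := b 1 1 2 3
  have i1 := b' 0 0 1 2
  have i2 := b' 0 0 1 3
  have i3 := b' 0 0 2 3
  have i4 := b' 0 1 2 3
  have i5 := b' 1 0 1 2
  have i6 := b' 1 0 1 3
  have i7 := b' 1 0 2 3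
  have i8 := b' 1 1 2 3
  simp [Fin.sum_univ_two, thetaFrame, leviMatrix, t1, t2, t3, t4, t5, anti20, anti30,
    anti31, s] at r1 r2 r3 r4 r5 r6 r7 r8 i1 i2 i3 i4 i5 i6 i7 i8
  clear b b'
  refine ⟨?_, ?_, ?_, ?_⟩
  · simp [websterScalar, Fin.sum_univ_two, d, anti20, anti31]
    linarith
  · linarith
  · linarith
  · linarith

theorem IsCurvature.clifford_contraction {Ω : Fin 2 → Fin 2 → Fin 4 → Fin 4 → ℂ}
    {t : Fin 2 → Fin 4 → ℂ} (h : IsCurvature Ω t) {f : Spinor 2} (hf : f ∈ positiveSpinors) :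
    cliffordE 0 (cliffordE 1 (spinRep (fun α β => Ω α β 0 1) f))
      + cliffordE 0 (cliffordE 2 (spinRep (fun α β => Ω α β 0 2) f))
      + cliffordE 0 (cliffordE 3 (spinRep (fun α β => Ω α β 0 3) f))
      + cliffordE 1 (cliffordE 2 (spinRep (fun α β => Ω α β 1 2) f))
      + cliffordE 1 (cliffordE 3 (spinRep (fun α β => Ω α β 1 3) f))
      + cliffordE 2 (cliffordE 3 (spinRep (fun α β => Ω α β 2 3) f))
      = websterScalar Ω • f := by
  obtain ⟨h1, h2, h3, h4⟩ := h.relations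
  have c1 := congrArg (fun r : ℝ => (r : ℂ)) h1
  have c2 := congrArg (fun r : ℝ => (r : ℂ)) h2
  have c3 := congrArg (fun r : ℝ => (r : ℂ)) h3
  have c4 := congrArg (fun r : ℝ => (r : ℂ)) h4
  push_cast at c1 c2 c3 c4
  have s := fun a b => spinRep_apply (h.skew a b) hf
  have hI : Complex.I ^ 2 = -1 := Complex.I_sq
  obtain ⟨f0, f1⟩ := mem_positiveSpinors.1 hf
  apply spinor_ext
  · simp only [Pi.add_apply, Pi.smul_apply, cliffordE_apply, s, Complex.real_smul]
    -- `c1` carries the scalar part and `c2`, `c3`, `c4` the three imaginary units; the multiple of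
    -- `hI` reduces the squares of i.
    linear_combination (-f ∅) * c1 + f {0, 1} * c2 + Complex.I * f {0, 1} * c3
      + Complex.I * f ∅ * c4 + (f ∅ * ((Ω 0 1 0 1).re + (Ω 0 1 0 3).im + (Ω 0 1 1 2).im
        - (1 / 2) * ((Ω 0 0 1 3).im - (Ω 1 1 1 3).im) + (Ω 0 1 2 3).re)
      - f {0, 1} * ((Ω 0 1 0 1).im + (Ω 0 1 2 3).im
        - (Ω 0 1 0 3).re - (Ω 0 1 1 2).re)
      - Complex.I * f ∅ * (Ω 0 1 1 3).im - Complex.I * f {0, 1} * (Ω 0 1 1 3).re) * hI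
  · simp [cliffordE_apply, s, f0]
  · simp [cliffordE_apply, s, f1]
  · simp only [Pi.add_apply, Pi.smul_apply, cliffordE_apply, s, Complex.real_smul]
    linear_combination (-f {0, 1}) * c1 - f ∅ * c2 + Complex.I * f ∅ * c3
      - Complex.I * f {0, 1} * c4 + (f {0, 1} * ((Ω 0 1 0 1).re + (Ω 0 1 0 3).im + (Ω 0 1 1 2).im
        - (1 / 2) * ((Ω 0 0 1 3).im - (Ω 1 1 1 3).im) + (Ω 0 1 2 3).re)
      + f ∅ * ((Ω 0 1 0 1).im + (Ω 0 1 2 3).im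
        - (Ω 0 1 0 3).re - (Ω 0 1 1 2).re)
      + Complex.I * f {0, 1} * (Ω 0 1 1 3).im - Complex.I * f ∅ * (Ω 0 1 1 3).re) * hI

end CurvatureAlgebra

/-! ### The Ricci identity for the spin connection -/

section Weitzenboeck

/-- `E_a` as a continuous real linear map. -/
def cliffordCLM (a : Fin 4) : Spinor 2 →L[ℝ] Spinor 2 :=
  LinearMap.toContinuousLinearMap ((cliffordE a).restrictScalars ℝ)

theorem spinRep_eq_sum (u : Fin 2 → Fin 2 → ℂ) (f : Spinor 2) :
    spinRep u f = ∑ a, ∑ b, ((1 / 4 : ℝ) * realify u a b) • cliffordE a (cliffordE b f) := by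
  have hs : spinRep u = (1 / 4 : ℝ) • ∑ a, ∑ b, realify u a b • (cliffordE a * cliffordE b) := rfl
  rw [hs]
  simp only [LinearMap.smul_apply, LinearMap.sum_apply, Module.End.mul_apply, Finset.smul_sum,
    smul_smul]

/-- Bridge between the complex and the real connection matrices: it turns the structure equations
for θ^β into real bracket formulas. -/
theorem sum_thetaFrame_mul (u : Fin 2 → Fin 2 → ℂ) (β : Fin 2) (a : Fin 4) :
    ∑ α, thetaFrame α (some a) * u α β
      = realify u a (AdaptedFrame.idx β) + Complex.I * realify u a (AdaptedFrame.idxJ β) := by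
  fin_cases a <;> fin_cases β <;> apply Complex.ext <;> simp [thetaFrame, realify]

variable {M : Type*} [TopologicalSpace M] [ChartedSpace (EuclideanSpace ℝ (Fin 5)) M]
  [IsManifold (𝓡 5) ∞ M] {P : PseudohermitianStructure M}

namespace AdaptedFrame

variable {F : AdaptedFrame P}

theorem connR_eq (a b : Fin 4) (x : M) (v : TangentSpace (𝓡 5) x) :
    F.connR a b x v = realify (fun α β => F.connC α β x v) a b := by
  fin_cases a <;> fin_cases b <;> rfl

theorem spinForm_eq (x : M) (v : TangentSpace (𝓡 5) x) :
    F.spinForm x v = spinRep (fun α β => F.connC α β x v) := by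
  unfold spinForm
  simp only [connR_eq]
  rfl

variable (F) in
/-- The connection matrix evaluated on a member of the frame. -/
def connMatrix (A : Option (Fin 4)) (x : M) : Fin 2 → Fin 2 → ℂ := fun α β => F.connFun α β A x

theorem isSkew_connMatrix {x : M} (hx : x ∈ F.U) (A : Option (Fin 4)) : IsSkew (F.connMatrix A x) :=
  fun α β => connC_skew hx α β _

theorem nabla_full (A : Option (Fin 4)) (φ : M → Spinor 2) (x : M) :
    F.nabla (F.full A) φ x = dirDeriv (F.full A) φ x + spinRep (F.connMatrix A x) (φ x) := by
  unfold nabla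
  rw [spinForm_eq]
  rfl

/-- Tensoriality of ∇ in the direction: only the value of V at the point enters. -/
theorem nabla_sum {κ : Type*} (s : Finset κ) (a : κ → ℝ) (X : κ → VField M) (V : VField M)
    (φ : M → Spinor 2) (x : M) (hV : V x = ∑ k ∈ s, a k • X k x) :
    F.nabla V φ x = ∑ k ∈ s, a k • F.nabla (X k) φ x := by
  have h : (fun α β => F.connC α β x (V x)) = ∑ k ∈ s, a k • fun α β => F.connC α β x (X k x) := by
    funext α β
    simp only [hV, map_sum, map_smul, Finset.sum_apply, Pi.smul_apply]
  unfold nabla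
  simp only [spinForm_eq]
  rw [h, dirDeriv_field_sum s (fun k _ => a k) X V φ x hV, map_sum, LinearMap.sum_apply]
  simp only [map_smul, LinearMap.smul_apply, smul_add, Finset.sum_add_distrib]

/-- The pseudohermitian connection has no torsion in the `ξ`-component. -/
theorem br_eq_connection {x : M} (hx : x ∈ F.U) (a b c : Fin 4) :
    F.br (some a) (some b) (some c) x = realify (F.connMatrix (some a) x) b c
      - realify (F.connMatrix (some b) x) a c := by
  have h : ∀ β, (F.structureConstants x).complexBr β (some a) (some b)
      = ((realify (F.connMatrix (some a) x) b (idx β)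
          - realify (F.connMatrix (some b) x) a (idx β) : ℝ) : ℂ)
        + Complex.I * ((realify (F.connMatrix (some a) x) b (idxJ β)
          - realify (F.connMatrix (some b) x) a (idxJ β) : ℝ) : ℂ) := by
    intro β
    have h1 := sum_thetaFrame_mul (F.connMatrix (some a) x) β b
    have h2 := sum_thetaFrame_mul (F.connMatrix (some b) x) β a
    unfold connMatrix at h1 h2
    rw [complexBr_horizontal hx, Finset.sum_sub_distrib, h1, h2]
    unfold connMatrix
    push_cast
    ring
  have hre : ∀ β, F.br (some a) (some b) (some (idx β)) x = realify (F.connMatrix (some a) x) b (idx β)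
          - realify (F.connMatrix (some b) x) a (idx β) := fun β => by
    simpa [StructureConstants.complexBr, structureConstants] using congrArg Complex.re (h β)
  have him : ∀ β, F.br (some a) (some b) (some (idxJ β)) x
      = realify (F.connMatrix (some a) x) b (idxJ β)
          - realify (F.connMatrix (some b) x) a (idxJ β) := fun β => by
    simpa [StructureConstants.complexBr, structureConstants] using congrArg Complex.im (h β)
  fin_cases c
  · exact hre 0
  · exact hre 1
  · exact him 0
  · exact him 1

theorem smooth_realify (A : Option (Fin 4)) (a b : Fin 4) :
    SmoothFun (fun y => realify (F.connMatrix A y) a b) F.U := by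
  obtain ⟨α, β, L, hL⟩ := exists_realify_eq a b
  simp only [hL]
  exact (F.smooth_connFun α β A).clm L

theorem dirDeriv_realify (X : VField M) {x : M} (hx : x ∈ F.U) (A : Option (Fin 4)) (a b : Fin 4) :
    dirDeriv X (fun y => realify (F.connMatrix A y) a b) x
      = realify (fun α β => dirDeriv X (F.connFun α β A) x) a b := by
  obtain ⟨α, β, L, hL⟩ := exists_realify_eq a b
  simp only [hL]
  exact dirDeriv_clm X L ((F.smooth_connFun α β A).mdifferentiableAt F.isOpen_U hx)

theorem smooth_spinRep (A : Option (Fin 4)) {φ : M → Spinor 2} (hφ : SmoothFun φ F.U) :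
    SmoothFun (fun y => spinRep (F.connMatrix A y) (φ y)) F.U := by
  simp only [spinRep_eq_sum]
  refine contMDiffOn_finsetSum fun a _ => contMDiffOn_finsetSum fun b _ => ?_
  exact ((smooth_realify A a b).clm ((1 / 4 : ℝ) • ContinuousLinearMap.id ℝ ℝ)).smul
    ((hφ.clm (cliffordCLM b)).clm (cliffordCLM a))

theorem dirDeriv_spinRep (X : VField M) {x : M} (hx : x ∈ F.U) (A : Option (Fin 4))
    {φ : M → Spinor 2} (hφ : SmoothFun φ F.U) :
    dirDeriv X (fun y => spinRep (F.connMatrix A y) (φ y)) x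
      = spinRep (fun α β => dirDeriv X (F.connFun α β A) x) (φ x)
        + spinRep (F.connMatrix A x) (dirDeriv X φ x) := by
  have hr : ∀ a b, SmoothFun (fun y => (1 / 4 : ℝ) * realify (F.connMatrix A y) a b) F.U :=
    fun a b => (smooth_realify A a b).clm ((1 / 4 : ℝ) • ContinuousLinearMap.id ℝ ℝ)
  have hdr : ∀ a b, dirDeriv X (fun y => (1 / 4 : ℝ) * realify (F.connMatrix A y) a b) x
      = (1 / 4 : ℝ) * realify (fun α β => dirDeriv X (F.connFun α β A) x) a b := fun a b => by
    rw [← dirDeriv_realify X hx]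
    exact dirDeriv_clm X ((1 / 4 : ℝ) • ContinuousLinearMap.id ℝ ℝ)
      ((smooth_realify A a b).mdifferentiableAt F.isOpen_U hx)
  have hE : ∀ a b, SmoothFun (fun y => cliffordE a (cliffordE b (φ y))) F.U := fun a b =>
    (hφ.clm (cliffordCLM b)).clm (cliffordCLM a)
  have hdE : ∀ a b, dirDeriv X (fun y => cliffordE a (cliffordE b (φ y))) x
      = cliffordE a (cliffordE b (dirDeriv X φ x)) := fun a b =>
    dirDeriv_clm X ((cliffordCLM a).comp (cliffordCLM b)) (hφ.mdifferentiableAt F.isOpen_U hx)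
  have hd : ∀ a b, MDifferentiableAt (𝓡 5) 𝓘(ℝ, Spinor 2)
      (fun y => ((1 / 4 : ℝ) * realify (F.connMatrix A y) a b)
        • cliffordE a (cliffordE b (φ y))) x := fun a b =>
    SmoothFun.mdifferentiableAt ((hr a b).smul (hE a b)) F.isOpen_U hx
  have h1 := fun a => dirDeriv_sum X Finset.univ (fun b _ => hd a b)
  simp only [spinRep_eq_sum]
  rw [(dirDeriv_sum X Finset.univ (fun a _ => (h1 a).2)).1, ← Finset.sum_add_distrib]
  refine Finset.sum_congr rfl fun a _ => ?_
  rw [(h1 a).1, ← Finset.sum_add_distrib]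
  refine Finset.sum_congr rfl fun b _ => ?_
  rw [dirDeriv_smul X ((hr a b).mdifferentiableAt F.isOpen_U hx)
    ((hE a b).mdifferentiableAt F.isOpen_U hx), hdr, hdE, add_comm]

theorem smooth_dirDeriv_spinor (A : Option (Fin 4)) {φ : M → Spinor 2} (hφ : SmoothFun φ F.U) :
    SmoothFun (dirDeriv (F.full A) φ) F.U :=
  SmoothFun.dirDeriv_spinor F.isOpen_U F.smooth_θ_U (F.smooth_full none) P.θ_T (F.smooth_full A) hφ

theorem smooth_nabla (A : Option (Fin 4)) {φ : M → Spinor 2} (hφ : SmoothFun φ F.U) :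
    SmoothFun (F.nabla (F.full A) φ) F.U := by
  have h : F.nabla (F.full A) φ
      = fun y => dirDeriv (F.full A) φ y + spinRep (F.connMatrix A y) (φ y) :=
    funext (nabla_full A φ)
  rw [h]
  exact ContMDiffOn.add (smooth_dirDeriv_spinor A hφ) (smooth_spinRep A hφ)

theorem nabla_nabla {x : M} (hx : x ∈ F.U) (A B : Option (Fin 4)) {φ : M → Spinor 2}
    (hφ : SmoothFun φ F.U) :
    F.nabla (F.full A) (F.nabla (F.full B) φ) x
      = dirDeriv (F.full A) (dirDeriv (F.full B) φ) x
        + spinRep (fun α β => dirDeriv (F.full A) (F.connFun α β B) x) (φ x)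
        + spinRep (F.connMatrix B x) (dirDeriv (F.full A) φ x)
        + spinRep (F.connMatrix A x) (dirDeriv (F.full B) φ x)
        + spinRep (F.connMatrix A x) (spinRep (F.connMatrix B x) (φ x)) := by
  have h : F.nabla (F.full B) φ
      = fun y => dirDeriv (F.full B) φ y + spinRep (F.connMatrix B y) (φ y) :=
    funext (nabla_full B φ)
  rw [nabla_full, h, dirDeriv_add _
    ((smooth_dirDeriv_spinor B hφ).mdifferentiableAt F.isOpen_U hx)
    ((smooth_spinRep B hφ).mdifferentiableAt F.isOpen_U hx), dirDeriv_spinRep _ hx B hφ, map_add]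
  abel

theorem nabla2_eq (a b : Fin 4) (φ : M → Spinor 2) (x : M) :
    F.nabla2 a b φ x = F.nabla (F.e a) (F.nabla (F.e b) φ) x
      - ∑ c, realify (F.connMatrix (some a) x) b c • F.nabla (F.e c) φ x := by
  unfold nabla2
  rw [nabla_sum Finset.univ (fun c => F.connR b c x (F.e a x)) F.e (F.nablaE (F.e a) b) φ x rfl]
  simp only [connR_eq]
  rfl

theorem dirDeriv_positive (X : VField M) {x : M} (hx : x ∈ F.U) {φ : M → Spinor 2}
    (hφ : SmoothFun φ F.U) (hp : ∀ y ∈ F.U, φ y ∈ positiveSpinors) :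
    dirDeriv X φ x ∈ positiveSpinors := by
  have h : ∀ K : Finset (Fin 2), (∀ y ∈ F.U, φ y K = 0) → dirDeriv X φ x K = 0 := by
    intro K hK
    have h1 := dirDeriv_clm X (ContinuousLinearMap.proj (R := ℝ)
      (φ := fun _ : Finset (Fin 2) => ℂ) K) (hφ.mdifferentiableAt F.isOpen_U hx)
    exact h1.symm.trans (dirDeriv_eq_zero X 0 F.isOpen_U hK hx)
  exact mem_positiveSpinors.2 ⟨h _ fun y hy => (mem_positiveSpinors.1 (hp y hy)).1,
    h _ fun y hy => (mem_positiveSpinors.1 (hp y hy)).2⟩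

/-- The vanishing components of φ have zero derivative, and the spin representation is even. The
case of T is the one needed to annihilate the ∇_T terms. -/
theorem nabla_positive (A : Option (Fin 4)) {x : M} (hx : x ∈ F.U) {φ : M → Spinor 2}
    (hφ : SmoothFun φ F.U) (hp : ∀ y ∈ F.U, φ y ∈ positiveSpinors) :
    F.nabla (F.full A) φ x ∈ positiveSpinors := by
  rw [nabla_full]
  exact add_mem (dirDeriv_positive _ hx hφ hp) (spinRep_mem (isSkew_connMatrix hx A) (hp x hx))

theorem isCurvature {x : M} (hx : x ∈ F.U) :
    IsCurvature (F.curvFrame x) (fun β a => F.torsFun β (some a) x) where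
  anti := curvFrame_anti x
  skew a b α β := curvFrame_skew hx α β a b
  bianchi := bianchi hx
  tors := torsFun_symm hx

/-- The Ricci identity for the spin connection on positive spinors. -/
theorem nabla2_sub_nabla2 {x : M} (hx : x ∈ F.U) (a b : Fin 4) {φ : M → Spinor 2}
    (hφ : SmoothFun φ F.U) (hp : ∀ y ∈ F.U, φ y ∈ positiveSpinors) :
    F.nabla2 a b φ x - F.nabla2 b a φ x
      = spinRep (fun α β => F.curvFrame x α β a b) (φ x)
        - leviMatrix a b • F.nabla (F.full none) φ x := by
  have hcomm := dirDeriv_mlieBracket_spinor F.isOpen_U F.smooth_θ_U (F.smooth_full none) P.θ_T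
    (F.smooth_full (some a)) (F.smooth_full (some b)) hφ hx
  rw [dirDeriv_field_sum Finset.univ (fun E => F.br (some a) (some b) E) F.full _ φ x
    (mlieBracket_full hx _ _)] at hcomm
  have hn : ∀ E, dirDeriv (F.full E) φ x
      = F.nabla (F.full E) φ x - spinRep (F.connMatrix E x) (φ x) := fun E => by
    rw [nabla_full, add_sub_cancel_right]
  have hbr : ∑ E, F.br (some a) (some b) E x • dirDeriv (F.full E) φ x
      = -leviMatrix a b • F.nabla (F.full none) φ x
        + ∑ c, realify (F.connMatrix (some a) x) b c • F.nabla (F.e c) φ x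
        - ∑ c, realify (F.connMatrix (some b) x) a c • F.nabla (F.e c) φ x
        - spinRep (∑ E, F.br (some a) (some b) E x • F.connMatrix E x) (φ x) := by
    have h1 : spinRep (∑ E, F.br (some a) (some b) E x • F.connMatrix E x) (φ x)
        = ∑ E, F.br (some a) (some b) E x • spinRep (F.connMatrix E x) (φ x) := by
      rw [map_sum, LinearMap.sum_apply]
      simp only [map_smul, LinearMap.smul_apply]
    have h2 : ∑ E, F.br (some a) (some b) E x • F.nabla (F.full E) φ x
        = -leviMatrix a b • F.nabla (F.full none) φ x
        + ∑ c, (realify (F.connMatrix (some a) x) b c • F.nabla (F.e c) φ x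
        - realify (F.connMatrix (some b) x) a c • F.nabla (F.e c) φ x) := by
      -- The T-component of [e_a, e_b] gives the ∇_T term; the ξ-components are the difference of
      -- the two covariant derivatives and cancel against the correction terms of ∇².
      rw [Fintype.sum_option, br_none hx]
      simp only [br_eq_connection hx, sub_smul]
      rfl
    rw [h1, add_sub_assoc, ← Finset.sum_sub_distrib, ← h2, ← Finset.sum_sub_distrib]
    simp only [hn, smul_sub]
  have hΩ : (fun α β => F.curvFrame x α β a b)
      = (fun α β => dirDeriv (F.full (some a)) (F.connFun α β (some b)) x)
        - (fun α β => dirDeriv (F.full (some b)) (F.connFun α β (some a)) x)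
        - (∑ E, F.br (some a) (some b) E x • F.connMatrix E x)
        - (fun α β => ∑ γ, (F.connMatrix (some a) x α γ * F.connMatrix (some b) x γ β
          - F.connMatrix (some b) x α γ * F.connMatrix (some a) x γ β)) := by
    funext α β
    rw [curvFrame_eq hx]
    simp only [Pi.sub_apply, Finset.sum_apply, Pi.smul_apply, Complex.real_smul]
    rfl
  have hb := spinRep_bracket (isSkew_connMatrix hx (some a)) (isSkew_connMatrix hx (some b))
    (hp x hx)
  have hab := nabla_nabla hx (some a) (some b) hφ
  have hba := nabla_nabla hx (some b) (some a) hφ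
  rw [hΩ, map_sub, map_sub, map_sub, LinearMap.sub_apply, LinearMap.sub_apply,
    LinearMap.sub_apply, nabla2_eq, nabla2_eq]
  simp only [full] at hab hba hcomm hbr ⊢
  rw [hab, hba]
  rw [hbr] at hcomm
  -- The mixed terms with one derivative of φ are symmetric in a, b and cancel; `hcomm` handles the
  -- second derivatives and `hb` the products of connection matrices.
  linear_combination (norm := module) (1 : ℝ) • hb - (1 : ℝ) • hcomm

end AdaptedFrame

end Weitzenboeck

/-! ### The square of the contact Dirac operator -/

section DiracSquare

variable {M : Type*} [TopologicalSpace M] [ChartedSpace (EuclideanSpace ℝ (Fin 5)) M]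
  [IsManifold (𝓡 5) ∞ M] {P : PseudohermitianStructure M}

namespace AdaptedFrame

variable {F : AdaptedFrame P}

theorem clifford_e {x : M} (hx : x ∈ F.U) (a : Fin 4) : F.clifford x (F.e a x) = cliffordE a := by
  rw [cliffordE_eq]
  unfold clifford
  congr 1
  funext b
  rw [F.coframe_e b a x hx, Pi.single_apply]

theorem dirac_eq {x : M} (hx : x ∈ F.U) (φ : M → Spinor 2) :
    F.dirac φ x = ∑ a, cliffordE a (F.nabla (F.e a) φ x) := by
  unfold dirac
  simp only [clifford_e hx]

/-- Clifford multiplication is parallel: moving the spin connection form past e_b produces ∇_{e_a}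
e_b, which is absorbed in ∇². -/
theorem nabla_dirac {x : M} (hx : x ∈ F.U) (a : Fin 4) {φ : M → Spinor 2} (hφ : SmoothFun φ F.U) :
    F.nabla (F.e a) (F.dirac φ) x
      = ∑ b, cliffordE b (F.nabla2 a b φ x) := by
  have hsm : ∀ b, SmoothFun (fun y => cliffordE b (F.nabla (F.e b) φ y)) F.U := fun b =>
    (smooth_nabla (some b) hφ).clm (cliffordCLM b)
  have hd : ∀ b, dirDeriv (F.e a) (fun y => cliffordE b (F.nabla (F.e b) φ y)) x
      = cliffordE b (dirDeriv (F.e a) (F.nabla (F.e b) φ) x) := fun b =>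
    dirDeriv_clm (F.e a) (cliffordCLM b)
      ((smooth_nabla (some b) hφ).mdifferentiableAt F.isOpen_U hx)
  have hskew := isSkew_connMatrix hx (some a)
  have h1 : F.nabla (F.e a) (F.dirac φ) x
      = dirDeriv (F.e a) (F.dirac φ) x + spinRep (F.connMatrix (some a) x) (F.dirac φ x) :=
    nabla_full (some a) _ x
  have h2 : ∀ b, F.nabla (F.e a) (F.nabla (F.e b) φ) x
      = dirDeriv (F.e a) (F.nabla (F.e b) φ) x
        + spinRep (F.connMatrix (some a) x) (F.nabla (F.e b) φ x) :=
    fun b => nabla_full (some a) _ x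
  -- By skewness, differentiating the Clifford factors gives exactly the correction term that ∇²
  -- subtracts.
  have h3 : ∑ b, ∑ d, realify (F.connMatrix (some a) x) b d • cliffordE d (F.nabla (F.e b) φ x)
      = -∑ b, ∑ c, realify (F.connMatrix (some a) x) b c • cliffordE b (F.nabla (F.e c) φ x) := by
    rw [Finset.sum_comm, ← Finset.sum_neg_distrib]
    refine Finset.sum_congr rfl fun b _ => ?_
    rw [← Finset.sum_neg_distrib]
    refine Finset.sum_congr rfl fun c _ => ?_
    rw [realify_skew hskew c b, neg_smul]
  have hE : ∀ b (r : ℝ) (f : Spinor 2), cliffordE b (r • f) = r • cliffordE b f := fun b r f =>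
    (cliffordCLM b).map_smul r f
  rw [h1, dirac_eq hx, map_sum, dirDeriv_congr (F.e a) F.isOpen_U (fun y hy => dirac_eq hy φ) hx,
    (dirDeriv_sum (F.e a) Finset.univ
      fun b _ => (hsm b).mdifferentiableAt F.isOpen_U hx).1]
  simp only [hd, spinRep_commutator hskew, nabla2_eq, h2, map_sub, map_add, map_sum, hE,
    Finset.sum_add_distrib, Finset.sum_sub_distrib]
  rw [h3]
  abel

theorem scalarW_eq (x : M) : F.scalarW x = websterScalar (F.curvFrame x) := rfl

/-- The Weitzenböck formula for the contact Dirac operator on positive spinors. -/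
theorem dirac_dirac {x : M} (hx : x ∈ F.U) {φ : M → Spinor 2}
    (hφ : SmoothFun φ F.U) (hp : ∀ y ∈ F.U, φ y ∈ positiveSpinors) :
    F.dirac (F.dirac φ) x = F.connLaplacian φ x + F.scalarW x • φ x := by
  have hR := fun a b => nabla2_sub_nabla2 hx a b hφ hp
  have hC := (isCurvature hx).clifford_contraction (hp x hx)
  have hT := commute_reeb_positive (nabla_positive none hx hφ hp)
  have hE : ∀ b (r : ℝ) (f : Spinor 2), cliffordE b (r • f) = r • cliffordE b f := fun b r f =>
    (cliffordCLM b).map_smul r f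
  have hN : ∀ a b, F.nabla2 b a φ x = F.nabla2 a b φ x
      - spinRep (fun α β => F.curvFrame x α β a b) (φ x)
      + leviMatrix a b • F.nabla (F.full none) φ x := fun a b => by
    have := hR a b
    rw [sub_eq_iff_eq_add] at this
    rw [this]
    abel
  have hc : ∀ a b : Fin 4, a < b → ∀ f, cliffordE b (cliffordE a f)
      = -cliffordE a (cliffordE b f) := fun a b h f => cliffordE_anticomm h.ne f
  rw [scalarW_eq, ← hC, dirac_eq hx]
  simp only [nabla_dirac hx _ hφ, connLaplacian, Fin.sum_univ_four, map_add, cliffordE_sq]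
  -- With e_b e_a = -e_a e_b for a < b, each pair of mixed terms reduces to e_a e_b applied to the
  -- curvature term minus the ∇_T term.
  rw [hN 0 1, hN 0 2, hN 0 3, hN 1 2, hN 1 3, hN 2 3]
  simp only [map_add, map_sub, hE, hc 0 1 (by decide), hc 0 2 (by decide), hc 0 3 (by decide),
    hc 1 2 (by decide), hc 1 3 (by decide), hc 2 3 (by decide)]
  simp only [LinearMap.add_apply, Module.End.mul_apply] at hT
  simp [leviMatrix]
  -- The factor 2 is dθ(e_1, Je_1) = dθ(e_2, Je_2); the other pairs a < b have dθ(e_a, e_b) = 0.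
  linear_combination (norm := module) (-2 : ℝ) • hT

end AdaptedFrame

end DiracSquare

end

end PseudohermitianSpin

theorem corollary2 {M : Type*} [TopologicalSpace M]
    [ChartedSpace (EuclideanSpace ℝ (Fin 5)) M] [IsManifold (𝓡 5) ∞ M] {ι : Type*}
    (P : PseudohermitianSpin.PseudohermitianStructure M)
    (S : PseudohermitianSpin.SpinStructure P ι) :
    (∀ s ∈ PseudohermitianSpin.positiveSpinors,
      (PseudohermitianSpin.cliffordE 0 * PseudohermitianSpin.cliffordE 2
        + PseudohermitianSpin.cliffordE 1 * PseudohermitianSpin.cliffordE 3) s = 0) ∧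
    (∀ i, ∀ x ∈ (S.frame i).U, ∀ s ∈ PseudohermitianSpin.positiveSpinors,
      ((S.frame i).clifford x ((S.frame i).e 0 x) * (S.frame i).clifford x ((S.frame i).e 2 x)
        + (S.frame i).clifford x ((S.frame i).e 1 x)
          * (S.frame i).clifford x ((S.frame i).e 3 x)) s = 0) ∧
    ∀ φ : ι → M → PseudohermitianSpin.Spinor 2, S.IsPositiveSection φ →
      ∀ i, ∀ x ∈ (S.frame i).U,
        S.dirac (S.dirac φ) i x =
          S.connLaplacian φ i x + (S.frame i).scalarW x • φ i x := by
  refine ⟨fun s hs => PseudohermitianSpin.commute_reeb_positive hs, fun i x hx s hs => ?_,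
    fun φ hφ i x hx => ?_⟩
  · simp only [PseudohermitianSpin.AdaptedFrame.clifford_e hx]
    exact PseudohermitianSpin.commute_reeb_positive hs
  · exact PseudohermitianSpin.AdaptedFrame.dirac_dirac hx (hφ.1.1 i) (hφ.2 i)
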